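/- Let $R$ be a commutative ring (for example a field) and let $L$ be a (left) Leibniz algebra over $R$: an $R$-module with an $R$-bilinear bracket $\circ$ satisfying $x\circ(y\circ z)=(x\circ y)\circ z+y\circ(x\circ z)$. Let $Z=\{z\in L: z\circ e=0\ \forall e\in L\}$ be its left center, let $(x,y)=x\circ y+y\circ x\in Z$ be the symmetric product of $L$, let $S^\bullet(Z)$ be the symmetric algebra of $Z$, and for $e\in L$ let $\rho(e)$ be the derivation of $S^\bullet(Z)$ extending $f\mapsto e\circ f$ on $Z$. For $n\ge 0$ let $C^n(L)$ be the module of sequences $\omega=(\omega_0,\dots,\omega_{\lfloor n/2\rfloor})$, where $\omega_k(e_1,\dots,e_{n-2k};f_1,\dots,f_k)\in S^\bullet(Z)$ is $R$-multilinear in $e_1,\dots,e_{n-2k}\in L$ and $f_1,\dots,f_k\in Z$, is symmetric in the $f_j$, and is weakly skew-symmetric in the $e_i$: $$\omega_k(\dots,e_i,e_{i+1},\dots;f_1,\dots,f_k)+\omega_k(\dots,e_{i+1},e_i,\dots;f_1,\dots,f_k)=-\omega_{k+1}(\dots,\widehat{e_i},\widehat{e_{i+1}},\dots;(e_i,e_{i+1}),f_1,\dots,f_k).$$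 Put $C(L)=\bigoplus_{n\ge0}C^n(L)$ and $d=d_0+\delta$, where for $\omega\in C^n(L)$ $$(d_0\omega)_k(e_1,\dots,e_{n+1-2k};f_1,\dots,f_k)=\sum_a(-1)^{a+1}\rho(e_a)\,\omega_k(\dots,\widehat{e_a},\dots;f_1,\dots,f_k)+\sum_{a<b}(-1)^a\omega_k(\dots,\widehat{e_a},\dots,e_a\circ e_b,\dots;f_1,\dots,f_k)$$ (with $e_a\circ e_b$ in the place of $e_b$) and $$(\delta\omega)_k(e_1,\dots,e_{n+1-2k};f_1,\dots,f_k)=\sum_j\omega_{k-1}(f_j,e_1,\dots,e_{n+1-2k};\dots,\widehat{f_j},\dots).$$ For $\omega\in C^n(L)$ and $\eta\in C^m(L)$ define $$(\omega\cdot\eta)_k(e_1,\dots,e_{n+m-2k};f_1,\dots,f_k)=\sum_{i+j=k}\ \sum_{\substack{\sigma\in sh(n-2i,m-2j)\\ \mu\in sh(i,j)}}(-1)^\sigma\,\omega_i(e_{\sigma(1)},\dots,e_{\sigma(n-2i)};f_{\mu(1)},\dots,f_{\mu(i)})\,\eta_j(e_{\sigma(n-2i+1)},\dots;f_{\mu(i+1)},\dots),$$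 where $sh(p,q)$ is the set of permutations of $\{1,\dots,p+q\}$ that are increasing on the first $p$ and on the last $q$ positions, and $(-1)^\sigma$ is the sign of $\sigma$. Proposition. $C(L)$ with this product and $d$ is a differential graded commutative algebra. That is, extending both operations linearly to $C(L)$: $\omega\cdot\eta\in C^{n+m}(L)$ and $d\omega\in C^{n+1}(L)$ for $\omega\in C^n(L)$, $\eta\in C^m(L)$; the product is bilinear and associative, with unit $1\in S^0(Z)\subset C^0(L)$; $\omega\cdot\eta=(-1)^{nm}\eta\cdot\omega$; $d$ is linear with $d\circ d=0$; and $d(\omega\cdot\eta)=(d\omega)\cdot\eta+(-1)^n\omega\cdot(d\eta)$. -/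

import Mathlib

noncomputable section

/-- A (left) Leibniz algebra over `R`: an `R`-module with a bilinear bracket `x ∘ y = bracket x y`
such that every left multiplication is a derivation of the bracket. -/
class LeibnizAlgebra (R : Type*) (L : Type*) [CommRing R] [AddCommGroup L] [Module R L] where
  bracket : L →ₗ[R] L →ₗ[R] L
  left_leibniz : ∀ x y z : L,
    bracket x (bracket y z) = bracket (bracket x y) z + bracket y (bracket x z)

/-- A differential graded commutative algebra, given internally: the homogeneous parts `C n` are
submodules of an ambient module `A`, the total space is their (direct) sum `⨆ n, C n`, and the
product, the unit and the differential are the restrictions of `mul`, `one` and `d`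
(which are defined on all of `A`, where nothing else is asked of them than linearity). -/
structure IsDGCA {R A : Type*} [CommRing R] [AddCommGroup A] [Module R A] (C : ℕ → Submodule R A)
    (mul : A →ₗ[R] A →ₗ[R] A) (one : A) (d : A →ₗ[R] A) : Prop where
  /-- The sum of the homogeneous parts is direct. -/
  independent : iSupIndep C
  /-- The product of elements of degrees `n` and `m` has degree `n + m`. -/
  mul_mem : ∀ {n m : ℕ} {x y : A}, x ∈ C n → y ∈ C m → mul x y ∈ C (n + m)
  /-- The unit has degree `0`. -/
  one_mem : one ∈ C 0
  /-- The differential has degree `1`. -/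
  d_mem : ∀ {n : ℕ} {x : A}, x ∈ C n → d x ∈ C (n + 1)
  one_mul : ∀ {x : A}, x ∈ ⨆ n, C n → mul one x = x
  mul_one : ∀ {x : A}, x ∈ ⨆ n, C n → mul x one = x
  mul_assoc : ∀ {x y z : A}, x ∈ ⨆ n, C n → y ∈ ⨆ n, C n → z ∈ ⨆ n, C n →
    mul (mul x y) z = mul x (mul y z)
  /-- Graded commutativity. -/
  mul_comm : ∀ {n m : ℕ} {x y : A}, x ∈ C n → y ∈ C m →
    mul x y = (-1 : ℤ) ^ (n * m) • mul y x
  d_d : ∀ {x : A}, x ∈ ⨆ n, C n → d (d x) = 0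
  /-- The differential is a graded derivation. -/
  leibniz : ∀ {n m : ℕ} {x y : A}, x ∈ C n → y ∈ C m →
    d (mul x y) = mul (d x) y + (-1 : ℤ) ^ n • mul x (d y)

namespace LeibnizAlgebra

section Basics

variable (R : Type*) {L : Type*} [CommRing R] [AddCommGroup L] [Module R L] [LeibnizAlgebra R L]

/-- The Leibniz bracket `x ∘ y`. -/
def br (x y : L) : L := bracket (R := R) x y

variable (L) in
/-- The left center `Z = {z ∈ L | z ∘ e = 0 for all e ∈ L}`. -/
def leftCenter : Submodule R L where
  carrier := {z | ∀ e : L, br R z e = 0}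
  zero_mem' := fun e => by simp [br]
  add_mem' := fun {x y} hx hy e => by
    have h₁ := hx e
    have h₂ := hy e
    simp only [br] at h₁ h₂ ⊢
    simp [h₁, h₂]
  smul_mem' := fun c x hx e => by
    have h₁ := hx e
    simp only [br] at h₁ ⊢
    simp [h₁]

/-- The symmetric product `(x, y) = x ∘ y + y ∘ x`, which takes values in the left center. -/
def pairing (x y : L) : leftCenter R L :=
  ⟨br R x y + br R y x, fun e => by
    have h₁ := left_leibniz (R := R) x y e
    have h₂ := left_leibniz (R := R) y x e
    simp only [br, map_add, LinearMap.add_apply]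
    rw [h₂, ← add_assoc] at h₁
    exact right_eq_add.mp h₁⟩

/-- The left action `f ↦ e ∘ f` of an element `e` of `L` on the left center. -/
def centerAction (e : L) : leftCenter R L →ₗ[R] leftCenter R L :=
  ((bracket (R := R) e).comp (leftCenter R L).subtype).codRestrict (leftCenter R L) (fun f x => by
    have h₁ := left_leibniz (R := R) e (f : L) x
    have h₂ : bracket (R := R) (f : L) x = 0 := f.2 x
    have h₃ : bracket (R := R) (f : L) (bracket (R := R) e x) = 0 := f.2 _
    rw [h₂, h₃, map_zero, add_zero] at h₁
    exact h₁.symm)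

end Basics

section SymmetricAlgebraDerivation

variable {R : Type*} {M : Type*} [CommRing R] [AddCommGroup M] [Module R M]

/-- The algebra map `x ↦ x + ε D(x)` to the dual numbers which underlies `symDerivation`. -/
def symDerivationAux (D : M →ₗ[R] M) :
    SymmetricAlgebra R M →ₐ[R] TrivSqZeroExt (SymmetricAlgebra R M) (SymmetricAlgebra R M) :=
  SymmetricAlgebra.lift
    { toFun := fun m => TrivSqZeroExt.inl (SymmetricAlgebra.ι R M m)
        + TrivSqZeroExt.inr (SymmetricAlgebra.ι R M (D m))
      map_add' := fun x y => by ext <;> simp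
      map_smul' := fun c x => by ext <;> simp }

theorem symDerivationAux_fst (D : M →ₗ[R] M) (x : SymmetricAlgebra R M) :
    (symDerivationAux D x).fst = x := by
  have h : (TrivSqZeroExt.fstHom R (SymmetricAlgebra R M) (SymmetricAlgebra R M)).comp
      (symDerivationAux D) = AlgHom.id R _ := by
    apply SymmetricAlgebra.algHom_ext
    ext m
    simp [symDerivationAux]
  exact DFunLike.congr_fun h x

/-- The extension of a linear endomorphism `D` of `M` to the symmetric algebra of `M` by the
Leibniz rule, i.e. the derivation of the symmetric algebra that restricts to `D` on `M`. -/
def symDerivation (D : M →ₗ[R] M) :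
    Derivation R (SymmetricAlgebra R M) (SymmetricAlgebra R M) :=
  Derivation.mk'
    ((TrivSqZeroExt.sndHom (SymmetricAlgebra R M) (SymmetricAlgebra R M)).restrictScalars R ∘ₗ
      (symDerivationAux D).toLinearMap)
    (fun a b => by simp [symDerivationAux_fst, _root_.mul_comm])

theorem symDerivation_ι (D : M →ₗ[R] M) (m : M) :
    symDerivation D (SymmetricAlgebra.ι R M m) = SymmetricAlgebra.ι R M (D m) := by
  simp [symDerivation, symDerivationAux]

end SymmetricAlgebraDerivation

section Shuffles

/-- The shuffle permutations `sh(a, p - a)` of `p` letters: the permutations `σ` that are increasing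
on the first `a` positions and increasing on the last `p - a` positions. -/
def shuffles (p a : ℕ) : Finset (Equiv.Perm (Fin p)) :=
  Finset.univ.filter fun σ => ∀ i j : Fin p, i < j → ((j : ℕ) < a ∨ a ≤ (i : ℕ)) → σ i < σ j

/-- The first `a` entries `(e_{σ(1)}, …, e_{σ(a)})` of the permuted tuple. -/
def firstPart {α : Type*} {p : ℕ} (a : Fin (p + 1)) (σ : Equiv.Perm (Fin p)) (e : Fin p → α) :
    Fin (a : ℕ) → α :=
  fun i => e (σ ⟨i, by omega⟩)

/-- The last `p - a` entries `(e_{σ(a+1)}, …, e_{σ(p)})` of the permuted tuple. -/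
def lastPart {α : Type*} {p : ℕ} (a : Fin (p + 1)) (σ : Equiv.Perm (Fin p)) (e : Fin p → α) :
    Fin (p - (a : ℕ)) → α :=
  fun i => e (σ ⟨a + i, by omega⟩)

end Shuffles

section Cochains

variable (R : Type*) (L : Type*) [CommRing R] [AddCommGroup L] [Module R L] [LeibnizAlgebra R L]

/-- The symmetric algebra `S^•(Z)` of the left center. -/
abbrev SZ : Type _ := SymmetricAlgebra R (leftCenter R L)

/-- The ambient module: families of arbitrary functions
`ω p k : L^p × Z^k → S^•(Z)`, `p, k ∈ ℕ`. In a cochain `(ω_0, ω_1, …)` of degree `n`,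
the component `ω_k` is `ω (n - 2 * k) k`, and all other components vanish. -/
abbrev PreCochain : Type _ :=
  (p k : ℕ) → (Fin p → L) → (Fin k → leftCenter R L) → SZ R L

variable {R L}

variable (R) in
/-- The action `ρ(e)` of `e ∈ L` on `S^•(Z)`: the extension of `f ↦ e ∘ f` by the Leibniz rule. -/
def rho (e : L) : Derivation R (SZ R L) (SZ R L) := symDerivation (centerAction R e)

/-- `ω` is an `n`-cochain of the standard complex of `L`. -/
structure IsCochain (n : ℕ) (ω : PreCochain R L) : Prop where
  /-- The only components of `ω` are the `ω_k` with `n - 2k` arguments in `L`. -/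
  homogeneous : ∀ p k : ℕ, p + 2 * k ≠ n → ω p k = 0
  /-- Multilinearity in the arguments from `L`. -/
  multilinear_left : ∀ (p k : ℕ) (f : Fin k → leftCenter R L),
    ∃ φ : MultilinearMap R (fun _ : Fin p => L) (SZ R L), ∀ e, φ e = ω p k e f
  /-- Multilinearity in the arguments from `Z`. -/
  multilinear_right : ∀ (p k : ℕ) (e : Fin p → L),
    ∃ φ : MultilinearMap R (fun _ : Fin k => leftCenter R L) (SZ R L), ∀ f, φ f = ω p k e f
  /-- Symmetry in the arguments from `Z`. -/
  symmetric : ∀ (p k : ℕ) (e : Fin p → L) (f : Fin k → leftCenter R L) (μ : Equiv.Perm (Fin k)),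
    ω p k e (f ∘ μ) = ω p k e f
  /-- Weak skew-symmetry of `ω_k` in the arguments from `L`, up to `ω_{k+1}`. The arguments
  `e_i` and `e_{i+1}` are exchanged on the left, and both are deleted on the right. -/
  weak_skew : ∀ (p k : ℕ) (e : Fin (p + 2) → L) (f : Fin k → leftCenter R L) (i : Fin (p + 1)),
    ω (p + 2) k e f + ω (p + 2) k (e ∘ Equiv.swap i.castSucc i.succ) f =
      - ω p (k + 1) (Fin.removeNth i (Fin.removeNth i.castSucc e))
          (Fin.cons (pairing R (e i.castSucc) (e i.succ)) f)

variable (R L) in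
/-- The module `C^n(L) = C^n(L, Z, S^•(Z))` of `n`-cochains. -/
def cochains (n : ℕ) : Submodule R (PreCochain R L) where
  carrier := {ω | IsCochain n ω}
  zero_mem' :=
    { homogeneous := fun _ _ _ => rfl
      multilinear_left := fun _ _ _ => ⟨0, fun _ => rfl⟩
      multilinear_right := fun _ _ _ => ⟨0, fun _ => rfl⟩
      symmetric := fun _ _ _ _ _ => rfl
      weak_skew := fun _ _ _ _ _ => by simp }
  add_mem' := fun {ω η} hω hη =>
    { homogeneous := fun p k h => by
        simp [hω.homogeneous p k h, hη.homogeneous p k h]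
      multilinear_left := fun p k f => by
        obtain ⟨φ, hφ⟩ := hω.multilinear_left p k f
        obtain ⟨ψ, hψ⟩ := hη.multilinear_left p k f
        exact ⟨φ + ψ, fun e => by simp [hφ, hψ]⟩
      multilinear_right := fun p k e => by
        obtain ⟨φ, hφ⟩ := hω.multilinear_right p k e
        obtain ⟨ψ, hψ⟩ := hη.multilinear_right p k e
        exact ⟨φ + ψ, fun f => by simp [hφ, hψ]⟩
      symmetric := fun p k e f μ => by
        simp [hω.symmetric p k e f μ, hη.symmetric p k e f μ]
      weak_skew := fun p k e f i => by
        have h₁ := hω.weak_skew p k e f i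
        have h₂ := hη.weak_skew p k e f i
        simp only [Pi.add_apply]
        rw [add_add_add_comm, h₁, h₂, neg_add] }
  smul_mem' := fun c ω hω =>
    { homogeneous := fun p k h => by simp [hω.homogeneous p k h]
      multilinear_left := fun p k f => by
        obtain ⟨φ, hφ⟩ := hω.multilinear_left p k f
        exact ⟨c • φ, fun e => by simp [hφ]⟩
      multilinear_right := fun p k e => by
        obtain ⟨φ, hφ⟩ := hω.multilinear_right p k e
        exact ⟨c • φ, fun f => by simp [hφ]⟩
      symmetric := fun p k e f μ => by simp [hω.symmetric p k e f μ]
      weak_skew := fun p k e f i => by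
        have h₁ := hω.weak_skew p k e f i
        simp only [Pi.smul_apply]
        rw [← smul_add, h₁, smul_neg] }

/-- The formula for `d₀`. Positions are counted from `0`, so that the sign `(-1)^(a+1)` of the
position `a` counted from `1` is `(-1)^a` here. In the second sum `e_b` is replaced by `e_a ∘ e_b`
and `e_a` is deleted. -/
def d₀Fun (ω : PreCochain R L) : PreCochain R L
  | 0, _, _, _ => 0
  | p + 1, k, e, f =>
      (∑ a : Fin (p + 1), (-1 : ℤ) ^ (a : ℕ) • rho R (e a) (ω p k (Fin.removeNth a e) f))
      + ∑ a : Fin (p + 1), ∑ b ∈ Finset.univ.filter (fun b : Fin (p + 1) => a < b),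
          (-1 : ℤ) ^ ((a : ℕ) + 1) •
            ω p k (Fin.removeNth a (Function.update e b (br R (e a) (e b)))) f

/-- The formula for `δ`. -/
def δFun (ω : PreCochain R L) : PreCochain R L
  | _, 0, _, _ => 0
  | p, k + 1, e, f =>
      ∑ j : Fin (k + 1), ω (p + 1) k (Fin.cons (f j : L) e) (Fin.removeNth j f)

/-- The formula for the shuffle product. For `ω` of degree `n` and `η` of degree `m` only the terms
with `a = n - 2i` and `p - a = m - 2(k - i)` can be nonzero. -/
def mulFun (ω η : PreCochain R L) : PreCochain R L := fun p k e f =>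
  ∑ i : Fin (k + 1), ∑ a : Fin (p + 1), ∑ σ ∈ shuffles p a, ∑ μ ∈ shuffles k i,
    ((Equiv.Perm.sign σ : ℤˣ) : ℤ) •
      (ω a i (firstPart a σ e) (firstPart i μ f) *
        η (p - a) (k - i) (lastPart a σ e) (lastPart i μ f))

variable (R L)

/-- The operator `d₀`. -/
def d₀ : PreCochain R L →ₗ[R] PreCochain R L where
  toFun := d₀Fun
  map_add' := fun ω η => by
    funext p k e f
    cases p with
    | zero => simp [d₀Fun]
    | succ p =>
      simp only [d₀Fun, Pi.add_apply, map_add, smul_add, Finset.sum_add_distrib]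
      exact add_add_add_comm _ _ _ _
  map_smul' := fun c ω => by
    funext p k e f
    cases p with
    | zero => simp [d₀Fun]
    | succ p =>
      simp only [d₀Fun, Pi.smul_apply, Derivation.map_smul, smul_comm _ c, Finset.smul_sum,
        smul_add, RingHom.id_apply]

/-- The operator `δ`. -/
def δ : PreCochain R L →ₗ[R] PreCochain R L where
  toFun := δFun
  map_add' := fun ω η => by
    funext p k e f
    cases k with
    | zero => simp [δFun]
    | succ k => simp only [δFun, Pi.add_apply, Finset.sum_add_distrib]
  map_smul' := fun c ω => by
    funext p k e f
    cases k with
    | zero => simp [δFun]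
    | succ k => simp only [δFun, Pi.smul_apply, Finset.smul_sum, RingHom.id_apply]

/-- The differential `d = d₀ + δ` of the standard complex. -/
def d : PreCochain R L →ₗ[R] PreCochain R L := d₀ R L + δ R L

/-- The shuffle product, as a bilinear map. -/
def mul : PreCochain R L →ₗ[R] PreCochain R L →ₗ[R] PreCochain R L :=
  LinearMap.mk₂ R mulFun
    (fun ω₁ ω₂ η => by
      funext p k e f
      simp only [mulFun, Pi.add_apply, add_mul, smul_add, Finset.sum_add_distrib])
    (fun c ω η => by
      funext p k e f
      simp only [mulFun, Pi.smul_apply, smul_mul_assoc, smul_comm _ c, Finset.smul_sum])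
    (fun ω η₁ η₂ => by
      funext p k e f
      simp only [mulFun, Pi.add_apply, mul_add, smul_add, Finset.sum_add_distrib])
    (fun c ω η => by
      funext p k e f
      simp only [mulFun, Pi.smul_apply, mul_smul_comm, smul_comm _ c, Finset.smul_sum])

/-- The unit: the `0`-cochain with value `1 ∈ S^0(Z)`. -/
def one : PreCochain R L := fun p k _ _ => if p = 0 ∧ k = 0 then 1 else 0

end Cochains

end LeibnizAlgebra

end

/-!
The proof is a Cartan calculus. A precochain is determined by its value without arguments and by its
contractions: `contractL x` fills in the first argument from `L`, and `contractZ z` the first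
argument from the left center `Z`. All operations of the complex have simple commutation rules with
the contractions:

* `contractL x` is an odd and `contractZ z` an even derivation of the shuffle product
  (`contractL_mul`, `contractZ_mul`). This is the recursion for shuffles according to the block which
  contains the first letter (`sum_shuffles_succ`).
* On cochains there is a Lie derivative `lieDeriv x`, an even derivation of the product, with
  `contractL x ∘ d = - d ∘ contractL x + lieDeriv x` and
  `contractZ z ∘ d = d ∘ contractZ z + contractL z` (`contractL_d`, `contractZ_d`). The formula for
  `d₀` does not act on the arguments from `Z`; that part of the Lie derivative comes from `δ`, through
  weak skew-symmetry and the identity `(x, z) = x ∘ z` for `z ∈ Z`.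

Two coinduction principles then reduce everything to formal computations. A family of expressions
vanishes if its members vanish without arguments and their contractions are combinations of members
(`eq_zero_of_contract_mem_span`); this gives the algebra laws, the derivation rules,
`[lieDeriv x, d] = 0` and `d ∘ d = 0`. And a submodule which is closed under contractions consists of
multilinear, symmetric and weakly skew-symmetric families if these conditions hold for the first
arguments of each type (`IsContractionStable.mem_cochains`), where weak skew-symmetry becomes the
relation `contractL x ∘ contractL y + contractL y ∘ contractL x = - contractZ (x, y)`; this shows that
the product, the Lie derivatives and `d` preserve cochains. No grading is needed in these arguments:
the degree only enters through the involution `parity` and the trivial count of arguments.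
-/

namespace LeibnizAlgebra

open Equiv

/-! ### Recursion for shuffles -/

/-- The permutation of `p + 1` letters which fixes the first letter and permutes the others
by `σ`. -/
def extendPerm {p : ℕ} (σ : Perm (Fin p)) : Perm (Fin (p + 1)) :=
  Perm.decomposeFin.symm (0, σ)

@[simp]
theorem extendPerm_zero {p : ℕ} (σ : Perm (Fin p)) : extendPerm σ 0 = 0 := by
  simp [extendPerm]

@[simp]
theorem extendPerm_succ {p : ℕ} (σ : Perm (Fin p)) (i : Fin p) :
    extendPerm σ i.succ = (σ i).succ := by
  simp [extendPerm]

@[simp]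
theorem sign_extendPerm {p : ℕ} (σ : Perm (Fin p)) :
    Perm.sign (extendPerm σ) = Perm.sign σ := by
  simp [extendPerm]

theorem extendPerm_injective {p : ℕ} : Function.Injective (extendPerm (p := p)) := by
  intro σ τ h
  simpa [extendPerm] using h

theorem exists_extendPerm {p : ℕ} {τ : Perm (Fin (p + 1))} (h : τ 0 = 0) :
    ∃ σ, extendPerm σ = τ := by
  obtain ⟨⟨i, σ⟩, rfl⟩ := Perm.decomposeFin.symm.surjective τ
  rw [Perm.decomposeFin_symm_apply_zero] at h
  exact ⟨σ, by rw [h]; rfl⟩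

theorem mem_shuffles {p a : ℕ} {σ : Perm (Fin p)} : σ ∈ shuffles p a ↔
    ∀ i j : Fin p, i < j → ((j : ℕ) < a ∨ a ≤ (i : ℕ)) → σ i < σ j := by
  simp [shuffles]

theorem extendPerm_mem_shuffles {p a : ℕ} {σ : Perm (Fin p)} :
    extendPerm σ ∈ shuffles (p + 1) (a + 1) ↔ σ ∈ shuffles p a := by
  rw [mem_shuffles, mem_shuffles]
  constructor
  · intro h i j hij ha
    simpa using h i.succ j.succ (by simpa using hij) (by simpa using ha)
  · intro h i j hij ha
    cases j using Fin.cases with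
    | zero => simp at hij
    | succ j =>
      cases i using Fin.cases with
      | zero => simp
      | succ i => simpa using h i j (by simpa using hij) (by simpa using ha)

theorem extendPerm_mul_cycleRange_mem_shuffles {p : ℕ} {a : Fin (p + 1)} {σ : Perm (Fin p)} :
    extendPerm σ * Fin.cycleRange a ∈ shuffles (p + 1) a ↔ σ ∈ shuffles p a := by
  rw [mem_shuffles, mem_shuffles]
  constructor
  · intro h i j hij ha
    have h₁ := h (a.succAbove i) (a.succAbove j) (by simpa using hij) (by
      rcases ha with ha | ha
      · left
        rw [Fin.succAbove_of_castSucc_lt _ _ (by simpa [Fin.lt_def] using ha)]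
        simpa using ha
      · right
        rw [Fin.succAbove_of_le_castSucc _ _ (by simpa [Fin.le_def] using ha)]
        simp only [Fin.val_succ]
        omega)
    simpa [Fin.cycleRange_succAbove] using h₁
  · intro h i j hij ha
    rw [Fin.lt_def] at hij
    have hj : j ≠ a := by
      rintro rfl
      omega
    obtain ⟨j, rfl⟩ := Fin.exists_succAbove_eq hj
    by_cases hi : i = a
    · subst hi
      simp [Fin.cycleRange_succAbove]
    · obtain ⟨i, rfl⟩ := Fin.exists_succAbove_eq hi
      have h₁ := h i j (by simpa using (Fin.lt_def.mpr hij : a.succAbove i < a.succAbove j)) (by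
        rcases ha with ha | ha
        · left
          by_contra hc
          rw [Fin.succAbove_of_le_castSucc _ _ (by simpa [Fin.le_def] using hc)] at ha
          simp only [Fin.val_succ] at ha
          omega
        · right
          by_contra hc
          rw [Fin.succAbove_of_castSucc_lt _ _ (by simpa [Fin.lt_def] using hc)] at ha
          simp only [Fin.val_castSucc] at ha
          omega)
      simpa [Fin.cycleRange_succAbove] using h₁

/-- In a shuffle the first letter is sent to one of the first positions of the two blocks. -/
theorem val_eq_of_mem_shuffles {p a : ℕ} {τ : Perm (Fin (p + 1))} (hτ : τ ∈ shuffles (p + 1) a)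
    {b : Fin (p + 1)} (hb : τ b = 0) (h : ¬ (τ 0 = 0 ∧ a ≠ 0)) : (b : ℕ) = a := by
  rw [mem_shuffles] at hτ
  rcases lt_trichotomy (b : ℕ) a with hlt | heq | hgt
  · exfalso
    by_cases hb0 : b = 0
    · subst hb0
      exact h ⟨hb, by omega⟩
    · have := hτ 0 b (Fin.pos_iff_ne_zero.mpr hb0) (Or.inl hlt)
      simp [hb] at this
  · exact heq
  · exfalso
    have := hτ ⟨a, by omega⟩ b (by simpa [Fin.lt_def] using hgt) (Or.inr le_rfl)
    simp [hb] at this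

/-- Recursion for sums over shuffles of `p + 1` letters into two blocks: the first letter is either
the first entry of the first block or the first entry of the second block. -/
theorem sum_shuffles_succ {M : Type*} [AddCommMonoid M] (p : ℕ)
    (g : Fin (p + 2) → Perm (Fin (p + 1)) → M) :
    ∑ a : Fin (p + 2), ∑ σ ∈ shuffles (p + 1) a, g a σ =
      ∑ a : Fin (p + 1), ∑ σ ∈ shuffles p a, g a.succ (extendPerm σ) +
      ∑ a : Fin (p + 1), ∑ σ ∈ shuffles p a,
        g a.castSucc (extendPerm σ * Fin.cycleRange a) := by
  have hsplit : ∀ a : Fin (p + 2), ∑ σ ∈ shuffles (p + 1) a, g a σ =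
      ∑ σ ∈ (shuffles (p + 1) a).filter (fun τ => τ 0 = 0 ∧ (a : ℕ) ≠ 0), g a σ +
      ∑ σ ∈ (shuffles (p + 1) a).filter (fun τ => ¬ (τ 0 = 0 ∧ (a : ℕ) ≠ 0)), g a σ := fun a =>
    (Finset.sum_filter_add_sum_filter_not _ _ _).symm
  simp only [hsplit, Finset.sum_add_distrib]
  congr 1
  · rw [Fin.sum_univ_succ]
    simp only [Fin.val_zero, ne_eq, not_true_eq_false, and_false, Finset.filter_false,
      Finset.sum_empty, zero_add]
    refine Finset.sum_congr rfl fun a _ => (Finset.sum_nbij extendPerm ?_ ?_ ?_ ?_).symm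
    · intro σ hσ
      simpa [extendPerm_mem_shuffles] using hσ
    · exact extendPerm_injective.injOn
    · intro τ hτ
      simp only [Fin.val_succ, Finset.coe_filter, Set.mem_ofPred_eq] at hτ
      obtain ⟨σ, rfl⟩ := exists_extendPerm hτ.2.1
      exact ⟨σ, extendPerm_mem_shuffles.mp hτ.1, rfl⟩
    · intro σ _
      rfl
  · rw [Fin.sum_univ_castSucc]
    have hlast : ((shuffles (p + 1) (Fin.last (p + 1) : Fin (p + 2))).filter
        (fun τ => ¬ (τ 0 = 0 ∧ ((Fin.last (p + 1) : Fin (p + 2)) : ℕ) ≠ 0))) = ∅ := by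
      rw [Finset.filter_eq_empty_iff]
      intro τ hτ hc
      have := val_eq_of_mem_shuffles hτ (b := τ.symm 0) (by simp) hc
      simp only [Fin.val_last] at this
      omega
    rw [hlast, Finset.sum_empty, add_zero]
    refine Finset.sum_congr rfl fun a _ =>
      (Finset.sum_nbij (fun σ => extendPerm σ * Fin.cycleRange a) ?_ ?_ ?_ ?_).symm
    · intro σ hσ
      simp only [Finset.mem_filter, Fin.val_castSucc]
      refine ⟨extendPerm_mul_cycleRange_mem_shuffles.mpr hσ, ?_⟩
      rintro ⟨h₁, h₂⟩
      have h₃ : extendPerm σ (Fin.cycleRange a 0) = extendPerm σ (Fin.cycleRange a a) := by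
        rw [Fin.cycleRange_self, extendPerm_zero]
        exact h₁
      have h₄ := (Fin.cycleRange a).injective ((extendPerm σ).injective h₃)
      exact h₂ (by rw [← h₄]; rfl)
    · intro σ _ τ _ h
      exact extendPerm_injective (mul_right_cancel h)
    · intro τ hτ
      simp only [Fin.val_castSucc, Finset.coe_filter, Set.mem_ofPred_eq] at hτ
      have h₁ : (τ.symm 0 : Fin (p + 1)) = a :=
        Fin.ext (val_eq_of_mem_shuffles hτ.1 (by simp) hτ.2)
      obtain ⟨σ, hσ⟩ := exists_extendPerm (τ := τ * (Fin.cycleRange a)⁻¹) (by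
        rw [Perm.mul_apply, Perm.inv_def, Fin.cycleRange_symm_zero, ← h₁]
        simp)
      have h₂ : extendPerm σ * Fin.cycleRange a = τ := by rw [hσ]; simp
      refine ⟨σ, ?_, h₂⟩
      rw [← h₂] at hτ
      exact extendPerm_mul_cycleRange_mem_shuffles.mp hτ.1
    · intro σ _
      rfl

section Blocks

variable {α : Type*} {p : ℕ}

theorem firstPart_extendPerm (a : Fin (p + 1)) (σ : Perm (Fin p)) (x : α) (e : Fin p → α) :
    firstPart a.succ (extendPerm σ) (Fin.cons x e : Fin (p + 1) → α)
      = (Fin.cons x (firstPart a σ e) : Fin ((a : ℕ) + 1) → α) := by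
  funext i
  cases i using Fin.cases with
  | zero => exact congrArg (Fin.cons x e : Fin (p + 1) → α) (extendPerm_zero σ)
  | succ i =>
    exact congrArg (Fin.cons x e : Fin (p + 1) → α) (extendPerm_succ σ ⟨i, by omega⟩)

theorem lastPart_extendPerm (a : Fin (p + 1)) (σ : Perm (Fin p)) (x : α) (e : Fin p → α)
    (i : Fin (p + 1 - (a.succ : ℕ))) :
    lastPart a.succ (extendPerm σ) (Fin.cons x e : Fin (p + 1) → α) i
      = lastPart a σ e (i.cast (by simp)) := by
  have h : (⟨(a.succ : ℕ) + i, by omega⟩ : Fin (p + 1)) =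
      Fin.succ ⟨(a : ℕ) + i, by have := i.2; simp only [Fin.val_succ] at this; omega⟩ := by
    ext
    simp only [Fin.val_succ]
    omega
  simp only [lastPart, h, extendPerm_succ, Fin.cons_succ]
  rfl

theorem firstPart_extendPerm_mul_cycleRange (a : Fin (p + 1)) (σ : Perm (Fin p)) (x : α)
    (e : Fin p → α) :
    firstPart a.castSucc (extendPerm σ * Fin.cycleRange a) (Fin.cons x e : Fin (p + 1) → α)
      = firstPart a σ e := by
  funext i
  have hi : (i : ℕ) < a := i.2
  have h : (⟨(i : ℕ), by omega⟩ : Fin (p + 1)) = a.succAbove ⟨i, by omega⟩ := by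
    rw [Fin.succAbove_of_castSucc_lt _ _ (by simp [Fin.lt_def])]
    rfl
  simp only [firstPart, h, Perm.mul_apply, Fin.cycleRange_succAbove, extendPerm_succ,
    Fin.cons_succ]

theorem lastPart_extendPerm_mul_cycleRange (a : Fin (p + 1)) (σ : Perm (Fin p)) (x : α)
    (e : Fin p → α) (i : Fin (p + 1 - (a.castSucc : ℕ))) :
    lastPart a.castSucc (extendPerm σ * Fin.cycleRange a) (Fin.cons x e : Fin (p + 1) → α) i
      = (Fin.cons x (lastPart a σ e) : Fin (p - (a : ℕ) + 1) → α)
        (i.cast (by simp only [Fin.val_castSucc]; omega)) := by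
  obtain ⟨j, rfl⟩ : ∃ j : Fin (p - (a : ℕ) + 1),
      i = j.cast (by simp only [Fin.val_castSucc]; omega) :=
    ⟨i.cast (by simp only [Fin.val_castSucc]; omega), rfl⟩
  cases j using Fin.cases with
  | zero =>
    simp [lastPart]
  | succ j =>
    have hj := j.2
    have h : (⟨(a.castSucc : ℕ) + ((j : ℕ) + 1), by simp only [Fin.val_castSucc]; omega⟩ :
        Fin (p + 1)) = a.succAbove ⟨(a : ℕ) + j, by omega⟩ := by
      rw [Fin.succAbove_of_le_castSucc _ _ (by simp [Fin.le_def])]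
      ext
      simp only [Fin.val_castSucc, Fin.val_succ]
      omega
    simp only [lastPart, Fin.val_cast, Fin.val_succ, h, Perm.mul_apply, Fin.cycleRange_succAbove,
      extendPerm_succ, Fin.cons_succ, Fin.cast_cast, Fin.cast_eq_self]

end Blocks

/-! ### Contractions and the shuffle product -/

section Contractions

variable {R L : Type*} [CommRing R] [AddCommGroup L] [Module R L] [LeibnizAlgebra R L]

/-- The contraction with `x ∈ L`, which fills in the first argument from `L`. -/
def contractL (x : L) : PreCochain R L →ₗ[R] PreCochain R L where
  toFun ω := fun p k e f => ω (p + 1) k (Fin.cons x e) f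
  map_add' _ _ := rfl
  map_smul' _ _ := rfl

/-- The contraction with `z ∈ Z`, which fills in the first argument from the left center. -/
def contractZ (z : leftCenter R L) : PreCochain R L →ₗ[R] PreCochain R L where
  toFun ω := fun p k e f => ω p (k + 1) e (Fin.cons z f)
  map_add' _ _ := rfl
  map_smul' _ _ := rfl

variable (R L) in
/-- The parity involution: `(-1)^p` on the components with `p` arguments from `L`. As the degree of
such a component is `p + 2k`, it is `(-1)^n` on the cochains of degree `n`. -/
def parity : PreCochain R L →ₗ[R] PreCochain R L where
  toFun ω := fun p k e f => (-1 : ℤ) ^ p • ω p k e f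
  map_add' _ _ := by
    funext p k e f
    exact smul_add _ _ _
  map_smul' c ω := by
    funext p k e f
    exact smul_comm _ c _

theorem contractL_apply (x : L) (ω : PreCochain R L) (p k : ℕ) (e : Fin p → L)
    (f : Fin k → leftCenter R L) : contractL x ω p k e f = ω (p + 1) k (Fin.cons x e) f := rfl

theorem contractZ_apply (z : leftCenter R L) (ω : PreCochain R L) (p k : ℕ) (e : Fin p → L)
    (f : Fin k → leftCenter R L) : contractZ z ω p k e f = ω p (k + 1) e (Fin.cons z f) := rfl

theorem parity_apply (ω : PreCochain R L) (p k : ℕ) (e : Fin p → L)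
    (f : Fin k → leftCenter R L) : parity R L ω p k e f = (-1 : ℤ) ^ p • ω p k e f := rfl

theorem contractL_contractZ (x : L) (z : leftCenter R L) (ω : PreCochain R L) :
    contractL x (contractZ z ω) = contractZ z (contractL x ω) := rfl

theorem contractL_parity (x : L) (ω : PreCochain R L) :
    contractL x (parity R L ω) = - parity R L (contractL x ω) := by
  funext p k e f
  simp [contractL_apply, parity_apply, pow_succ]

theorem contractZ_parity (z : leftCenter R L) (ω : PreCochain R L) :
    contractZ z (parity R L ω) = parity R L (contractZ z ω) := rfl

theorem parity_parity (ω : PreCochain R L) : parity R L (parity R L ω) = ω := by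
  funext p k e f
  rw [parity_apply, parity_apply, smul_smul, ← mul_pow, neg_one_mul, neg_neg, one_pow, one_smul]

/-- A family of multilinear expressions vanishes as soon as its value without arguments vanishes
and its contractions are again combinations of members of the family. -/
theorem eq_zero_of_contract_mem_span {G : Set (PreCochain R L)}
    (h₀ : ∀ ω ∈ G, ω 0 0 = 0) (hL : ∀ ω ∈ G, ∀ x : L, contractL x ω ∈ Submodule.span R G)
    (hZ : ∀ ω ∈ G, ∀ z : leftCenter R L, contractZ z ω ∈ Submodule.span R G)
    {ω : PreCochain R L} (hω : ω ∈ G) : ω = 0 := by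
  have h₀' : ∀ ω ∈ Submodule.span R G, ω 0 0 = 0 := fun ω hω => by
    induction hω using Submodule.span_induction with
    | mem ω hω => exact h₀ ω hω
    | zero => rfl
    | add ω η _ _ h₁ h₂ => simp [h₁, h₂]
    | smul c ω _ h => simp [h]
  have hL' : ∀ x : L, Submodule.span R G ≤ (Submodule.span R G).comap (contractL x) := fun x =>
    Submodule.span_le.mpr fun ω hω => hL ω hω x
  have hZ' : ∀ z : leftCenter R L, Submodule.span R G ≤ (Submodule.span R G).comap (contractZ z) :=
    fun z => Submodule.span_le.mpr fun ω hω => hZ ω hω z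
  have key : ∀ (p k : ℕ) (e : Fin p → L) (f : Fin k → leftCenter R L),
      ∀ ω ∈ Submodule.span R G, ω p k e f = 0 := by
    intro p
    induction p with
    | zero =>
      intro k
      induction k with
      | zero =>
        intro e f ω hω
        rw [h₀' ω hω]
        rfl
      | succ k ih =>
        intro e f ω hω
        rw [← Fin.cons_self_tail f]
        exact ih e (Fin.tail f) _ (hZ' (f 0) hω)
    | succ p ih =>
      intro k e f ω hω
      rw [← Fin.cons_self_tail e]
      exact ih k (Fin.tail e) f _ (hL' (e 0) hω)
  funext p k e f
  exact key p k e f ω (Submodule.subset_span hω)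

/-- Evaluation of a precochain along equalities of the numbers of arguments. -/
theorem apply_congr (ω : PreCochain R L) {p p' k k' : ℕ} (hp : p = p') (hk : k = k')
    {e : Fin p → L} {e' : Fin p' → L} {f : Fin k → leftCenter R L} {f' : Fin k' → leftCenter R L}
    (he : ∀ i, e i = e' (i.cast hp)) (hf : ∀ i, f i = f' (i.cast hk)) :
    ω p k e f = ω p' k' e' f' := by
  subst hp hk
  exact congrArg₂ (ω p k) (funext he) (funext hf)

theorem mul_apply (ω η : PreCochain R L) (p k : ℕ) (e : Fin p → L)
    (f : Fin k → leftCenter R L) : mul R L ω η p k e f =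
      ∑ i : Fin (k + 1), ∑ a : Fin (p + 1), ∑ σ ∈ shuffles p a, ∑ μ ∈ shuffles k i,
        ((Equiv.Perm.sign σ : ℤˣ) : ℤ) •
          (ω a i (firstPart a σ e) (firstPart i μ f) *
            η (p - a) (k - i) (lastPart a σ e) (lastPart i μ f)) := rfl

theorem mul_zero_zero (ω η : PreCochain R L) (e : Fin 0 → L) (f : Fin 0 → leftCenter R L) :
    mul R L ω η 0 0 e f = ω 0 0 e f * η 0 0 e f := by
  have h : shuffles 0 0 = {1} := by decide
  rw [mul_apply]
  simp only [Fin.sum_univ_succ, Fin.sum_univ_zero, Fin.val_zero, h, Finset.sum_singleton, add_zero]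
  simp only [Perm.sign_one, Units.val_one, one_smul]
  exact congrArg₂ (· * ·)
    (apply_congr ω rfl rfl (fun i => i.elim0) (fun i => i.elim0))
    (apply_congr η rfl rfl (fun i => absurd i.2 (by simp)) (fun i => absurd i.2 (by simp)))

/-- The contraction with an element of `L` is an odd derivation of the shuffle product. -/
theorem contractL_mul (x : L) (ω η : PreCochain R L) :
    contractL x (mul R L ω η) =
      mul R L (contractL x ω) η + mul R L (parity R L ω) (contractL x η) := by
  funext p k e f
  simp only [Pi.add_apply, contractL_apply, mul_apply, parity_apply]
  rw [← Finset.sum_add_distrib]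
  refine Finset.sum_congr rfl fun i _ => ?_
  -- The argument `x` goes into the first block, or into the second block, past the first one.
  rw [sum_shuffles_succ]
  congr 1
  · refine Finset.sum_congr rfl fun a _ => Finset.sum_congr rfl fun σ _ =>
      Finset.sum_congr rfl fun μ _ => ?_
    rw [sign_extendPerm, firstPart_extendPerm]
    congr 2
    exact apply_congr η (by simp) rfl (lastPart_extendPerm a σ x e) fun _ => rfl
  · refine Finset.sum_congr rfl fun a _ => Finset.sum_congr rfl fun σ _ =>
      Finset.sum_congr rfl fun μ _ => ?_
    rw [firstPart_extendPerm_mul_cycleRange, apply_congr η (by simp only [Fin.val_castSucc]; omega)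
      rfl (lastPart_extendPerm_mul_cycleRange a σ x e) fun _ => rfl]
    rw [map_mul, sign_extendPerm, Fin.sign_cycleRange, smul_mul_assoc, smul_smul]
    simp

/-- The contraction with an element of `Z` is an even derivation of the shuffle product. -/
theorem contractZ_mul (z : leftCenter R L) (ω η : PreCochain R L) :
    contractZ z (mul R L ω η) =
      mul R L (contractZ z ω) η + mul R L ω (contractZ z η) := by
  funext p k e f
  simp only [Pi.add_apply, contractZ_apply, mul_apply]
  have hswap : ∀ (q : ℕ) (F : Fin (q + 1) → Fin (p + 1) → Perm (Fin p) → Perm (Fin q) → SZ R L),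
      ∑ i : Fin (q + 1), ∑ a : Fin (p + 1), ∑ σ ∈ shuffles p a, ∑ μ ∈ shuffles q i, F i a σ μ =
      ∑ a : Fin (p + 1), ∑ σ ∈ shuffles p a, ∑ i : Fin (q + 1), ∑ μ ∈ shuffles q i, F i a σ μ :=
    fun q F => by
      rw [Finset.sum_comm]
      exact Finset.sum_congr rfl fun a _ => Finset.sum_comm
  rw [hswap, hswap, hswap, ← Finset.sum_add_distrib]
  refine Finset.sum_congr rfl fun a _ => ?_
  rw [← Finset.sum_add_distrib]
  refine Finset.sum_congr rfl fun σ _ => ?_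
  rw [sum_shuffles_succ]
  congr 1
  · refine Finset.sum_congr rfl fun i _ => Finset.sum_congr rfl fun μ _ => ?_
    rw [firstPart_extendPerm]
    congr 2
    exact apply_congr η rfl (by simp) (fun _ => rfl) (lastPart_extendPerm i μ z f)
  · refine Finset.sum_congr rfl fun i _ => Finset.sum_congr rfl fun μ _ => ?_
    rw [firstPart_extendPerm_mul_cycleRange, apply_congr η rfl
      (by simp only [Fin.val_castSucc]; omega) (fun _ => rfl)
      (lastPart_extendPerm_mul_cycleRange i μ z f)]
    rfl

theorem parity_mul (ω η : PreCochain R L) :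
    parity R L (mul R L ω η) = mul R L (parity R L ω) (parity R L η) := by
  funext p k e f
  simp only [parity_apply, mul_apply, Finset.smul_sum]
  refine Finset.sum_congr rfl fun i _ => Finset.sum_congr rfl fun a _ =>
    Finset.sum_congr rfl fun σ _ => Finset.sum_congr rfl fun μ _ => ?_
  have h : (-1 : ℤ) ^ p = (-1) ^ (a : ℕ) * (-1) ^ (p - (a : ℕ)) := by
    rw [← pow_add]
    congr 1
    omega
  rw [smul_mul_smul_comm, h, smul_comm]

theorem contractL_one (x : L) : contractL x (one R L) = 0 := by
  funext p k e f
  simp [contractL_apply, one]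

theorem contractZ_one (z : leftCenter R L) : contractZ z (one R L) = 0 := by
  funext p k e f
  simp [contractZ_apply, one]

theorem parity_one : parity R L (one R L) = one R L := by
  funext p k e f
  by_cases h : p = 0 ∧ k = 0
  · simp [parity_apply, one, h]
  · simp [parity_apply, one, h]

/-! ### The algebra laws -/

theorem one_mul_eq (ω : PreCochain R L) : mul R L (one R L) ω = ω := by
  rw [← sub_eq_zero]
  refine eq_zero_of_contract_mem_span (G := {θ | ∃ ω, θ = mul R L (one R L) ω - ω})
    ?_ ?_ ?_ ⟨ω, rfl⟩
  · rintro _ ⟨ω, rfl⟩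
    funext e f
    simp only [Pi.sub_apply, mul_zero_zero]
    simp [one]
  · rintro _ ⟨ω, rfl⟩ x
    refine Submodule.subset_span ⟨contractL x ω, ?_⟩
    simp [map_sub, contractL_mul, contractL_one, parity_one]
  · rintro _ ⟨ω, rfl⟩ z
    refine Submodule.subset_span ⟨contractZ z ω, ?_⟩
    simp [map_sub, contractZ_mul, contractZ_one]

theorem mul_one_eq (ω : PreCochain R L) : mul R L ω (one R L) = ω := by
  rw [← sub_eq_zero]
  refine eq_zero_of_contract_mem_span (G := {θ | ∃ ω, θ = mul R L ω (one R L) - ω})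
    ?_ ?_ ?_ ⟨ω, rfl⟩
  · rintro _ ⟨ω, rfl⟩
    funext e f
    simp only [Pi.sub_apply, mul_zero_zero]
    simp [one]
  · rintro _ ⟨ω, rfl⟩ x
    refine Submodule.subset_span ⟨contractL x ω, ?_⟩
    simp [map_sub, contractL_mul, contractL_one]
  · rintro _ ⟨ω, rfl⟩ z
    refine Submodule.subset_span ⟨contractZ z ω, ?_⟩
    simp [map_sub, contractZ_mul, contractZ_one]

theorem mul_assoc_eq (ω η θ : PreCochain R L) :
    mul R L (mul R L ω η) θ = mul R L ω (mul R L η θ) := by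
  rw [← sub_eq_zero]
  set G : Set (PreCochain R L) :=
    {ζ | ∃ ω η θ, ζ = mul R L (mul R L ω η) θ - mul R L ω (mul R L η θ)} with hG
  have hmem : ∀ ω η θ, mul R L (mul R L ω η) θ - mul R L ω (mul R L η θ) ∈ Submodule.span R G :=
    fun ω η θ => Submodule.subset_span ⟨ω, η, θ, rfl⟩
  refine eq_zero_of_contract_mem_span (G := G) ?_ ?_ ?_ ⟨ω, η, θ, rfl⟩
  · rintro _ ⟨ω, η, θ, rfl⟩
    funext e f
    simp only [Pi.sub_apply, mul_zero_zero, _root_.mul_assoc, sub_self, Pi.zero_apply]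
  · rintro _ ⟨ω, η, θ, rfl⟩ x
    convert add_mem (hmem (contractL x ω) η θ)
      (add_mem (hmem (parity R L ω) (contractL x η) θ)
        (hmem (parity R L ω) (parity R L η) (contractL x θ))) using 1
    simp only [map_sub, map_add, contractL_mul, parity_mul, LinearMap.add_apply]
    abel
  · rintro _ ⟨ω, η, θ, rfl⟩ z
    convert add_mem (hmem (contractZ z ω) η θ)
      (add_mem (hmem ω (contractZ z η) θ) (hmem ω η (contractZ z θ))) using 1
    simp only [map_sub, map_add, contractZ_mul, LinearMap.add_apply]
    abel

/-- Graded commutativity. Only the parities `n` and `m` of the factors matter. -/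
theorem mul_comm_of_parity {n m : ℕ} {ω η : PreCochain R L}
    (hω : parity R L ω = (-1 : ℤ) ^ n • ω) (hη : parity R L η = (-1 : ℤ) ^ m • η) :
    mul R L ω η = (-1 : ℤ) ^ (n * m) • mul R L η ω := by
  rw [← sub_eq_zero]
  set G : Set (PreCochain R L) := {ζ | ∃ (n m : ℕ) (ω η : PreCochain R L),
    parity R L ω = (-1 : ℤ) ^ n • ω ∧ parity R L η = (-1 : ℤ) ^ m • η ∧
      ζ = mul R L ω η - (-1 : ℤ) ^ (n * m) • mul R L η ω} with hG
  have hmem : ∀ (n m : ℕ) (ω η : PreCochain R L), parity R L ω = (-1 : ℤ) ^ n • ω →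
      parity R L η = (-1 : ℤ) ^ m • η →
      mul R L ω η - (-1 : ℤ) ^ (n * m) • mul R L η ω ∈ Submodule.span R G :=
    fun n m ω η h₁ h₂ => Submodule.subset_span ⟨n, m, ω, η, h₁, h₂, rfl⟩
  have hodd : ∀ (n : ℕ) (ω : PreCochain R L) (x : L), parity R L ω = (-1 : ℤ) ^ n • ω →
      parity R L (contractL x ω) = (-1 : ℤ) ^ (n + 1) • contractL x ω := fun n ω x h => by
    rw [← neg_eq_iff_eq_neg.mpr (contractL_parity x ω), h, map_zsmul, pow_succ, mul_neg_one,
      neg_smul]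
  have heven : ∀ (n : ℕ) (ω : PreCochain R L) (z : leftCenter R L),
      parity R L ω = (-1 : ℤ) ^ n • ω →
      parity R L (contractZ z ω) = (-1 : ℤ) ^ n • contractZ z ω := fun n ω z h => by
    rw [← contractZ_parity, h, map_zsmul]
  refine eq_zero_of_contract_mem_span (G := G) ?_ ?_ ?_ ⟨n, m, ω, η, hω, hη, rfl⟩
  · rintro _ ⟨n, m, ω, η, hω, hη, rfl⟩
    have hsmul : (-1 : ℤ) ^ (n * m) • (mul R L η ω) 0 0 = mul R L η ω 0 0 := by
      have h₁ : ω 0 0 = (-1 : ℤ) ^ n • ω 0 0 := by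
        have := congrFun (congrFun hω 0) 0
        funext e f
        simpa [parity_apply] using congrFun (congrFun this e) f
      rcases Nat.even_or_odd n with hn | hn
      · rw [(hn.mul_right m).neg_one_pow, one_smul]
      -- For odd `n` the value of `ω` without arguments equals its negative, which absorbs the sign
      -- also where `2` is not invertible.
      · have h₂ : η 0 0 = (-1 : ℤ) ^ m • η 0 0 := by
          have := congrFun (congrFun hη 0) 0
          funext e f
          simpa [parity_apply] using congrFun (congrFun this e) f
        funext e f
        rw [Pi.smul_apply, Pi.smul_apply, mul_zero_zero, pow_mul, hn.neg_one_pow,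
          ← smul_mul_assoc]
        exact congrArg (· * _) (congrFun (congrFun h₂ e) f).symm
    funext e f
    have h := congrFun (congrFun hsmul e) f
    simp only [Pi.sub_apply, Pi.smul_apply, Pi.zero_apply] at h ⊢
    rw [h, mul_zero_zero, mul_zero_zero, _root_.mul_comm, sub_self]
  · rintro _ ⟨n, m, ω, η, hω, hη, rfl⟩ x
    convert add_mem (hmem (n + 1) m (contractL x ω) η (hodd n ω x hω) hη)
      (zsmul_mem (hmem n (m + 1) ω (contractL x η) hω (hodd m η x hη)) ((-1 : ℤ) ^ n)) using 1
    have h₁ : (-1 : ℤ) ^ n * (-1) ^ (n * (m + 1)) = (-1) ^ (n * m) := by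
      rw [← pow_add, show n + n * (m + 1) = n * m + 2 * n by ring, pow_add, pow_mul _ 2 n]
      simp
    have h₂ : (-1 : ℤ) ^ ((n + 1) * m) = (-1) ^ (n * m) * (-1) ^ m := by
      rw [← pow_add]
      ring_nf
    simp only [map_sub, map_zsmul, contractL_mul, hω, hη, LinearMap.smul_apply, smul_add, smul_sub,
      smul_smul, h₁, h₂]
    abel
  · rintro _ ⟨n, m, ω, η, hω, hη, rfl⟩ z
    convert add_mem (hmem n m (contractZ z ω) η (heven n ω z hω) hη)
      (hmem n m ω (contractZ z η) hω (heven m η z hη)) using 1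
    simp only [map_sub, map_zsmul, contractZ_mul, smul_add]
    abel

end Contractions

/-! ### Tuples -/

section Tuples

variable {α : Type*}

theorem eq_cons_cons {n : ℕ} (f : Fin (n + 2) → α) :
    f = (Fin.cons (f 0) (Fin.cons (f 1) (Fin.tail (Fin.tail f)) : Fin (n + 1) → α)) := by
  funext i
  cases i using Fin.cases with
  | zero => rfl
  | succ i =>
    cases i using Fin.cases with
    | zero => rfl
    | succ i => rfl

theorem cons_cons_comp_swap {n : ℕ} (x y : α) (f : Fin n → α) :
    (Fin.cons x (Fin.cons y f : Fin (n + 1) → α) : Fin (n + 2) → α) ∘ swap 0 1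
      = Fin.cons y (Fin.cons x f : Fin (n + 1) → α) := by
  funext i
  cases i using Fin.cases with
  | zero => simp
  | succ i =>
    cases i using Fin.cases with
    | zero => simp
    | succ i =>
      rw [Function.comp_apply, ← Fin.succ_zero_eq_one, swap_apply_of_ne_of_ne (Fin.succ_ne_zero _)
        (fun h => Fin.succ_ne_zero i (Fin.succ_injective _ h))]
      rfl

theorem cons_comp_swap_succ {n : ℕ} (x : α) (f : Fin n → α) (i j : Fin n) :
    (Fin.cons x f : Fin (n + 1) → α) ∘ swap i.succ j.succ = Fin.cons x (f ∘ swap i j) := by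
  funext l
  cases l using Fin.cases with
  | zero =>
    rw [Function.comp_apply, swap_apply_of_ne_of_ne (Fin.succ_ne_zero i).symm
      (Fin.succ_ne_zero j).symm]
    rfl
  | succ l =>
    rw [Function.comp_apply, ← Function.Injective.map_swap (Fin.succ_injective n)]
    rfl

theorem removeNth_succ_cons {n : ℕ} (x : α) (f : Fin (n + 1) → α) (i : Fin (n + 1)) :
    Fin.removeNth i.succ (Fin.cons x f : Fin (n + 2) → α)
      = (Fin.cons x (Fin.removeNth i f) : Fin (n + 1) → α) := by
  funext l
  cases l using Fin.cases with
  | zero => simp [Fin.removeNth]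
  | succ l => simp [Fin.removeNth]

end Tuples

section Structure

variable {R L : Type*} [CommRing R] [AddCommGroup L] [Module R L] [LeibnizAlgebra R L]

/-! ### Cochains in terms of contractions -/

/-- A submodule of precochains closed under contractions, in which the contractions depend linearly
on the element contracted with, contractions with elements of `Z` commute, and contractions with
elements of `L` anticommute up to the contraction with the symmetric product. -/
structure IsContractionStable (T : Submodule R (PreCochain R L)) : Prop where
  contractL_mem : ∀ ω ∈ T, ∀ x : L, contractL x ω ∈ T
  contractZ_mem : ∀ ω ∈ T, ∀ z : leftCenter R L, contractZ z ω ∈ T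
  contractL_add : ∀ ω ∈ T, ∀ x y : L, contractL (x + y) ω = contractL x ω + contractL y ω
  contractL_smul : ∀ ω ∈ T, ∀ (c : R) (x : L), contractL (c • x) ω = c • contractL x ω
  contractZ_add : ∀ ω ∈ T, ∀ x y : leftCenter R L,
    contractZ (x + y) ω = contractZ x ω + contractZ y ω
  contractZ_smul : ∀ ω ∈ T, ∀ (c : R) (x : leftCenter R L), contractZ (c • x) ω = c • contractZ x ω
  contractZ_comm : ∀ ω ∈ T, ∀ x y : leftCenter R L,
    contractZ x (contractZ y ω) = contractZ y (contractZ x ω)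
  contractL_anticomm : ∀ ω ∈ T, ∀ x y : L,
    contractL x (contractL y ω) + contractL y (contractL x ω) = - contractZ (pairing R x y) ω

/-- A submodule spanned by a set `G` is stable as soon as the conditions hold on `G`. -/
theorem isContractionStable_span {G : Set (PreCochain R L)}
    (hL : ∀ ω ∈ G, ∀ x : L, contractL x ω ∈ Submodule.span R G)
    (hZ : ∀ ω ∈ G, ∀ z : leftCenter R L, contractZ z ω ∈ Submodule.span R G)
    (hLa : ∀ ω ∈ G, ∀ x y : L, contractL (x + y) ω = contractL x ω + contractL y ω)
    (hLs : ∀ ω ∈ G, ∀ (c : R) (x : L), contractL (c • x) ω = c • contractL x ω)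
    (hZa : ∀ ω ∈ G, ∀ x y : leftCenter R L,
      contractZ (x + y) ω = contractZ x ω + contractZ y ω)
    (hZs : ∀ ω ∈ G, ∀ (c : R) (x : leftCenter R L), contractZ (c • x) ω = c • contractZ x ω)
    (hZc : ∀ ω ∈ G, ∀ x y : leftCenter R L,
      contractZ x (contractZ y ω) = contractZ y (contractZ x ω))
    (hLc : ∀ ω ∈ G, ∀ x y : L,
      contractL x (contractL y ω) + contractL y (contractL x ω) = - contractZ (pairing R x y) ω) :
    IsContractionStable (Submodule.span R G) := by
  have hle : ∀ φ : PreCochain R L →ₗ[R] PreCochain R L, (∀ ω ∈ G, φ ω = 0) →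
      ∀ ω ∈ Submodule.span R G, φ ω = 0 := fun φ h ω hω =>
    (Submodule.span_le (p := LinearMap.ker φ)).mpr (fun ω hω => h ω hω) hω
  constructor
  · exact fun ω hω x => (Submodule.span_le (p := (Submodule.span R G).comap (contractL x))).mpr
      (fun ω hω => hL ω hω x) hω
  · exact fun ω hω z => (Submodule.span_le (p := (Submodule.span R G).comap (contractZ z))).mpr
      (fun ω hω => hZ ω hω z) hω
  · intro ω hω x y
    exact sub_eq_zero.mp (hle (contractL (x + y) - (contractL x + contractL y))
      (fun ω hω => sub_eq_zero.mpr (hLa ω hω x y)) ω hω)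
  · intro ω hω c x
    exact sub_eq_zero.mp (hle (contractL (c • x) - c • contractL x)
      (fun ω hω => sub_eq_zero.mpr (hLs ω hω c x)) ω hω)
  · intro ω hω x y
    exact sub_eq_zero.mp (hle (contractZ (x + y) - (contractZ x + contractZ y))
      (fun ω hω => sub_eq_zero.mpr (hZa ω hω x y)) ω hω)
  · intro ω hω c x
    exact sub_eq_zero.mp (hle (contractZ (c • x) - c • contractZ x)
      (fun ω hω => sub_eq_zero.mpr (hZs ω hω c x)) ω hω)
  · intro ω hω x y
    exact sub_eq_zero.mp (hle (contractZ x ∘ₗ contractZ y - contractZ y ∘ₗ contractZ x)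
      (fun ω hω => sub_eq_zero.mpr (hZc ω hω x y)) ω hω)
  · intro ω hω x y
    exact sub_eq_zero.mp (hle
      (contractL x ∘ₗ contractL y + contractL y ∘ₗ contractL x - - contractZ (pairing R x y))
      (fun ω hω => sub_eq_zero.mpr (hLc ω hω x y)) ω hω)

section OfStable

variable {T : Submodule R (PreCochain R L)} (hT : IsContractionStable T)
include hT

theorem IsContractionStable.multilinear_left (p k : ℕ) (f : Fin k → leftCenter R L) :
    ∀ ω ∈ T, ∃ φ : MultilinearMap R (fun _ : Fin p => L) (SZ R L), ∀ e, φ e = ω p k e f := by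
  induction p with
  | zero =>
    intro ω _
    exact ⟨MultilinearMap.constOfIsEmpty R _ (ω 0 k Fin.elim0 f), fun e => by
      rw [Subsingleton.elim e Fin.elim0]
      rfl⟩
  | succ p ih =>
    intro ω hω
    choose φ hφ using fun x : L => ih _ (hT.contractL_mem ω hω x)
    let Φ : L →ₗ[R] MultilinearMap R (fun _ : Fin p => L) (SZ R L) :=
      { toFun := φ
        map_add' := fun x y => by
          ext e
          rw [add_apply, hφ, hφ, hφ, hT.contractL_add ω hω]
          rfl
        map_smul' := fun c x => by
          ext e
          rw [RingHom.id_apply, smul_apply, hφ, hφ, hT.contractL_smul ω hω]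
          rfl }
    refine ⟨LinearMap.uncurryLeft (M := fun _ : Fin (p + 1) => L) Φ, fun e => ?_⟩
    rw [LinearMap.uncurryLeft_apply]
    exact (hφ (e 0) (Fin.tail e)).trans (by rw [contractL_apply, Fin.cons_self_tail])

theorem IsContractionStable.multilinear_right (p k : ℕ) (e : Fin p → L) :
    ∀ ω ∈ T, ∃ φ : MultilinearMap R (fun _ : Fin k => leftCenter R L) (SZ R L),
      ∀ f, φ f = ω p k e f := by
  induction k with
  | zero =>
    intro ω _
    exact ⟨MultilinearMap.constOfIsEmpty R _ (ω p 0 e Fin.elim0), fun f => by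
      rw [Subsingleton.elim f Fin.elim0]
      rfl⟩
  | succ k ih =>
    intro ω hω
    choose φ hφ using fun x : leftCenter R L => ih _ (hT.contractZ_mem ω hω x)
    let Φ : leftCenter R L →ₗ[R] MultilinearMap R (fun _ : Fin k => leftCenter R L) (SZ R L) :=
      { toFun := φ
        map_add' := fun x y => by
          ext e
          rw [add_apply, hφ, hφ, hφ, hT.contractZ_add ω hω]
          rfl
        map_smul' := fun c x => by
          ext e
          rw [RingHom.id_apply, smul_apply, hφ, hφ, hT.contractZ_smul ω hω]
          rfl }
    refine ⟨LinearMap.uncurryLeft (M := fun _ : Fin (k + 1) => leftCenter R L) Φ, fun f => ?_⟩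
    rw [LinearMap.uncurryLeft_apply]
    exact (hφ (f 0) (Fin.tail f)).trans (by rw [contractZ_apply, Fin.cons_self_tail])

theorem IsContractionStable.swap_right (p k : ℕ) (e : Fin p → L) :
    ∀ ω ∈ T, ∀ (f : Fin (k + 1) → leftCenter R L) (i : Fin k),
      ω p (k + 1) e (f ∘ swap i.castSucc i.succ) = ω p (k + 1) e f := by
  induction k with
  | zero => exact fun _ _ _ i => i.elim0
  | succ k ih =>
    intro ω hω f i
    cases i using Fin.cases with
    | zero =>
      have h := congrFun (congrFun (congrFun (congrFun
        (hT.contractZ_comm ω hω (f 0) (f 1)) p) k) e) (Fin.tail (Fin.tail f))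
      simp only [contractZ_apply] at h
      rw [eq_cons_cons f, Fin.castSucc_zero, Fin.succ_zero_eq_one, cons_cons_comp_swap]
      exact h
    | succ i =>
      have h := ih _ (hT.contractZ_mem ω hω (f 0)) (Fin.tail f) i
      rw [← Fin.cons_self_tail f, Fin.castSucc_succ, cons_comp_swap_succ]
      exact h

theorem IsContractionStable.symmetric (p k : ℕ) (e : Fin p → L) (f : Fin k → leftCenter R L)
    (μ : Perm (Fin k)) (ω : PreCochain R L) (hω : ω ∈ T) : ω p k e (f ∘ μ) = ω p k e f := by
  cases k with
  | zero => exact congrArg (ω p 0 e) (Subsingleton.elim _ _)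
  | succ k =>
    have hμ : μ ∈ Submonoid.closure (Set.range fun i : Fin k => swap i.castSucc i.succ) := by
      rw [Perm.mclosure_swap_castSucc_succ]
      trivial
    induction hμ using Submonoid.closure_induction generalizing f with
    | mem μ hμ =>
      obtain ⟨i, rfl⟩ := hμ
      exact hT.swap_right p k e ω hω f i
    | one => rfl
    | mul μ ν _ _ h₁ h₂ => exact (h₂ (f ∘ μ)).trans (h₁ f)

theorem IsContractionStable.weak_skew (p k : ℕ) (f : Fin k → leftCenter R L) :
    ∀ ω ∈ T, ∀ (e : Fin (p + 2) → L) (i : Fin (p + 1)),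
      ω (p + 2) k e f + ω (p + 2) k (e ∘ swap i.castSucc i.succ) f =
        - ω p (k + 1) (Fin.removeNth i (Fin.removeNth i.castSucc e))
            (Fin.cons (pairing R (e i.castSucc) (e i.succ)) f) := by
  have hzero : ∀ (p : ℕ), ∀ ω ∈ T, ∀ (e : Fin (p + 2) → L),
      ω (p + 2) k e f + ω (p + 2) k (e ∘ swap 0 1) f =
        - ω p (k + 1) (Fin.tail (Fin.tail e)) (Fin.cons (pairing R (e 0) (e 1)) f) := by
    intro p ω hω e
    have h := congrFun (congrFun (congrFun (congrFun
      (hT.contractL_anticomm ω hω (e 0) (e 1)) p) k) (Fin.tail (Fin.tail e))) f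
    rw [add_comm]
    conv_lhs => rw [eq_cons_cons e, cons_cons_comp_swap]
    exact h
  induction p with
  | zero =>
    intro ω hω e i
    obtain rfl : i = 0 := Fin.fin_one_eq_zero i
    simpa using hzero 0 ω hω e
  | succ p ih =>
    intro ω hω e i
    cases i using Fin.cases with
    | zero => simpa using hzero (p + 1) ω hω e
    | succ i =>
      have h := ih _ (hT.contractL_mem ω hω (e 0)) (Fin.tail e) i
      conv_lhs => rw [← Fin.cons_self_tail e, Fin.castSucc_succ, cons_comp_swap_succ]
      refine Eq.trans h ?_
      conv_rhs => rw [← Fin.cons_self_tail e, Fin.castSucc_succ, removeNth_succ_cons,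
        removeNth_succ_cons, Fin.cons_succ, Fin.cons_succ]
      rfl

/-- The homogeneous elements of a contraction stable submodule are cochains. -/
theorem IsContractionStable.mem_cochains {ω : PreCochain R L} (hω : ω ∈ T) {n : ℕ}
    (hn : ∀ p k : ℕ, p + 2 * k ≠ n → ω p k = 0) : ω ∈ cochains R L n where
  homogeneous := hn
  multilinear_left p k f := hT.multilinear_left p k f ω hω
  multilinear_right p k e := hT.multilinear_right p k e ω hω
  symmetric p k e f μ := hT.symmetric p k e f μ ω hω
  weak_skew p k e f i := hT.weak_skew p k f ω hω e i

end OfStable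

theorem contractL_mem_cochains {n : ℕ} {ω : PreCochain R L} (hω : ω ∈ cochains R L n) (x : L) :
    contractL x ω ∈ cochains R L (n - 1) where
  homogeneous p k h := by
    funext e f
    rw [contractL_apply, hω.homogeneous (p + 1) k (by omega)]
    rfl
  multilinear_left p k f := by
    obtain ⟨φ, hφ⟩ := hω.multilinear_left (p + 1) k f
    exact ⟨MultilinearMap.curryLeft φ x, fun e => hφ _⟩
  multilinear_right p k e := hω.multilinear_right (p + 1) k _
  symmetric p k e f μ := hω.symmetric (p + 1) k _ f μ
  weak_skew p k e f i := by
    have h := hω.weak_skew (p + 1) k (Fin.cons x e) f i.succ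
    rw [Fin.castSucc_succ, cons_comp_swap_succ, removeNth_succ_cons, removeNth_succ_cons,
      Fin.cons_succ, Fin.cons_succ] at h
    exact h

theorem contractZ_mem_cochains {n : ℕ} {ω : PreCochain R L} (hω : ω ∈ cochains R L n)
    (z : leftCenter R L) : contractZ z ω ∈ cochains R L (n - 2) where
  homogeneous p k h := by
    funext e f
    rw [contractZ_apply, hω.homogeneous p (k + 1) (by omega)]
    rfl
  multilinear_left p k f := hω.multilinear_left p (k + 1) _
  multilinear_right p k e := by
    obtain ⟨φ, hφ⟩ := hω.multilinear_right p (k + 1) e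
    exact ⟨MultilinearMap.curryLeft φ z, fun f => hφ _⟩
  symmetric p k e f μ := by
    rw [contractZ_apply, contractZ_apply, ← hω.symmetric p (k + 1) e (Fin.cons z f) (extendPerm μ)]
    congr 1
    funext i
    cases i using Fin.cases with
    | zero => simp
    | succ i => simp
  weak_skew p k e f i := by
    have h := hω.weak_skew p (k + 1) e (Fin.cons z f) i
    rw [← hω.symmetric p (k + 1 + 1) _ _ (swap 0 1), cons_cons_comp_swap] at h
    exact h

theorem parity_eq_of_mem {n : ℕ} {ω : PreCochain R L} (hω : ω ∈ cochains R L n) :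
    parity R L ω = (-1 : ℤ) ^ n • ω := by
  funext p k e f
  rw [parity_apply]
  by_cases h : p + 2 * k = n
  · rw [← h, pow_add, pow_mul]
    simp
  · simp [hω.homogeneous p k h]

variable (R L) in
/-- The inhomogeneous cochains, i.e. the total space of the standard complex, are contraction
stable. -/
theorem isContractionStable_iSup_cochains : IsContractionStable (⨆ n, cochains R L n) := by
  rw [Submodule.iSup_eq_span]
  have hmem : ∀ {n : ℕ} {ω : PreCochain R L}, ω ∈ cochains R L n →
      ω ∈ Submodule.span R (⋃ n, (cochains R L n : Set (PreCochain R L))) := fun {n ω} h =>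
    Submodule.subset_span (Set.mem_iUnion.mpr ⟨n, h⟩)
  apply isContractionStable_span
  all_goals
    intro ω hω
    obtain ⟨n, hω⟩ := Set.mem_iUnion.mp hω
    replace hω : ω ∈ cochains R L n := hω
  · exact fun x => hmem (contractL_mem_cochains hω x)
  · exact fun z => hmem (contractZ_mem_cochains hω z)
  · intro x y
    funext p k e f
    obtain ⟨φ, hφ⟩ := hω.multilinear_left (p + 1) k f
    simp only [contractL_apply, Pi.add_apply, ← hφ]
    exact φ.cons_add e x y
  · intro c x
    funext p k e f
    obtain ⟨φ, hφ⟩ := hω.multilinear_left (p + 1) k f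
    simp only [contractL_apply, Pi.smul_apply, ← hφ]
    exact φ.cons_smul e c x
  · intro x y
    funext p k e f
    obtain ⟨φ, hφ⟩ := hω.multilinear_right p (k + 1) e
    simp only [contractZ_apply, Pi.add_apply, ← hφ]
    exact φ.cons_add f x y
  · intro c x
    funext p k e f
    obtain ⟨φ, hφ⟩ := hω.multilinear_right p (k + 1) e
    simp only [contractZ_apply, Pi.smul_apply, ← hφ]
    exact φ.cons_smul f c x
  · intro x y
    funext p k e f
    simp only [contractZ_apply]
    rw [← hω.symmetric p (k + 1 + 1) _ _ (swap 0 1), cons_cons_comp_swap]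
  · intro x y
    funext p k e f
    have h := hω.weak_skew p k (Fin.cons x (Fin.cons y e)) f 0
    rw [Fin.castSucc_zero, Fin.succ_zero_eq_one, cons_cons_comp_swap, Fin.removeNth_zero,
      Fin.removeNth_zero, Fin.tail_cons, Fin.tail_cons, add_comm] at h
    exact h

theorem parity_mem_iSup {ω : PreCochain R L} (hω : ω ∈ ⨆ n, cochains R L n) :
    parity R L ω ∈ ⨆ n, cochains R L n := by
  have h : (⨆ n, cochains R L n) ≤ (⨆ n, cochains R L n).comap (parity R L) :=
    iSup_le fun n ω hω => by
      rw [Submodule.mem_comap, parity_eq_of_mem hω]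
      exact zsmul_mem (Submodule.mem_iSup_of_mem n hω) _
  exact h hω

/-! ### The shuffle product of cochains -/

/-- The products of cochains span a contraction stable submodule: the mixed terms of the
anticommutator of two odd derivations cancel. -/
theorem isContractionStable_map₂_mul :
    IsContractionStable
      (Submodule.map₂ (mul R L) (⨆ n, cochains R L n) (⨆ n, cochains R L n)) := by
  set W := ⨆ n, cochains R L n with hW
  have hT := isContractionStable_iSup_cochains R L
  rw [← hW] at hT
  have hmem : ∀ {ω η}, ω ∈ W → η ∈ W → mul R L ω η ∈ Submodule.map₂ (mul R L) W W :=
    fun h₁ h₂ => Submodule.apply_mem_map₂ _ h₁ h₂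
  rw [Submodule.map₂_eq_span_image2] at hmem ⊢
  apply isContractionStable_span
  all_goals
    rintro _ ⟨ω, hω, η, hη, rfl⟩
    replace hω : ω ∈ W := hω
    replace hη : η ∈ W := hη
    have hω' : parity R L ω ∈ W := parity_mem_iSup hω
  · intro x
    rw [contractL_mul]
    exact add_mem (hmem (hT.contractL_mem ω hω x) hη) (hmem hω' (hT.contractL_mem η hη x))
  · intro z
    rw [contractZ_mul]
    exact add_mem (hmem (hT.contractZ_mem ω hω z) hη) (hmem hω (hT.contractZ_mem η hη z))
  · intro x y
    simp only [contractL_mul, hT.contractL_add ω hω, hT.contractL_add η hη, map_add,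
      LinearMap.add_apply]
    abel
  · intro c x
    simp only [contractL_mul, hT.contractL_smul ω hω, hT.contractL_smul η hη, map_smul,
      LinearMap.smul_apply, smul_add]
  · intro x y
    simp only [contractZ_mul, hT.contractZ_add ω hω, hT.contractZ_add η hη, map_add,
      LinearMap.add_apply]
    abel
  · intro c x
    simp only [contractZ_mul, hT.contractZ_smul ω hω, hT.contractZ_smul η hη, map_smul,
      LinearMap.smul_apply, smul_add]
  · intro x y
    simp only [contractZ_mul, map_add, hT.contractZ_comm ω hω x y, hT.contractZ_comm η hη x y]
    abel
  · intro x y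
    have h₁ := eq_sub_iff_add_eq.mpr (hT.contractL_anticomm ω hω x y)
    have h₂ := eq_sub_iff_add_eq.mpr (hT.contractL_anticomm η hη x y)
    simp only [contractL_mul, contractZ_mul, map_add, contractL_parity, parity_parity, map_neg,
      LinearMap.neg_apply]
    rw [h₁, h₂]
    simp only [map_sub, map_neg, LinearMap.sub_apply, LinearMap.neg_apply]
    abel

theorem mul_homogeneous {n m : ℕ} {ω η : PreCochain R L} (hω : ω ∈ cochains R L n)
    (hη : η ∈ cochains R L m) (p k : ℕ) (h : p + 2 * k ≠ n + m) : mul R L ω η p k = 0 := by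
  funext e f
  rw [mul_apply]
  refine Finset.sum_eq_zero fun i _ => Finset.sum_eq_zero fun a _ =>
    Finset.sum_eq_zero fun σ _ => Finset.sum_eq_zero fun μ _ => ?_
  by_cases h₁ : (a : ℕ) + 2 * (i : ℕ) = n
  · rw [hη.homogeneous _ _ (by omega), Pi.zero_apply, Pi.zero_apply, mul_zero, smul_zero]
  · rw [hω.homogeneous _ _ h₁, Pi.zero_apply, Pi.zero_apply, zero_mul, smul_zero]

theorem mul_mem_cochains {n m : ℕ} {ω η : PreCochain R L} (hω : ω ∈ cochains R L n)
    (hη : η ∈ cochains R L m) : mul R L ω η ∈ cochains R L (n + m) :=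
  isContractionStable_map₂_mul.mem_cochains
    (Submodule.apply_mem_map₂ _ (Submodule.mem_iSup_of_mem n hω) (Submodule.mem_iSup_of_mem m hη))
    (mul_homogeneous hω hη)

theorem mul_mem_iSup {ω η : PreCochain R L} (hω : ω ∈ ⨆ n, cochains R L n)
    (hη : η ∈ ⨆ n, cochains R L n) : mul R L ω η ∈ ⨆ n, cochains R L n := by
  induction hω using Submodule.iSup_induction' with
  | zero => simp
  | add ω₁ ω₂ _ _ h₁ h₂ =>
    rw [map_add]
    exact add_mem h₁ h₂
  | mem n ω hω =>
    induction hη using Submodule.iSup_induction' with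
    | zero => simp
    | add η₁ η₂ _ _ h₁ h₂ =>
      rw [map_add]
      exact add_mem h₁ h₂
    | mem m η hη => exact Submodule.mem_iSup_of_mem (n + m) (mul_mem_cochains hω hη)

variable (R L) in
theorem one_mem_cochains : one R L ∈ cochains R L 0 := by
  have hT : IsContractionStable (Submodule.span R {one R L}) := by
    apply isContractionStable_span <;>
    · rintro _ rfl
      simp [contractL_one, contractZ_one]
  refine hT.mem_cochains (Submodule.mem_span_singleton_self _) fun p k h => ?_
  funext e f
  simp only [one, Pi.zero_apply, ite_eq_right_iff]
  omega

variable (R L) in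
/-- Cochains of different degrees are supported on disjoint sets of components. -/
theorem iSupIndep_cochains : iSupIndep (cochains R L) := by
  intro n
  rw [Submodule.disjoint_def]
  intro ω hω hω'
  have hle : (⨆ m, ⨆ (_ : m ≠ n), cochains R L m) ≤
      ⨅ (p : ℕ) (k : ℕ) (_ : p + 2 * k = n), LinearMap.ker
        ((LinearMap.proj k : (∀ k : ℕ, (Fin p → L) → (Fin k → leftCenter R L) → SZ R L) →ₗ[R] _) ∘ₗ
          (LinearMap.proj p : PreCochain R L →ₗ[R] _)) := by
    refine iSup₂_le fun m hm η hη => ?_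
    simp only [Submodule.mem_iInf, LinearMap.mem_ker]
    intro p k h
    exact hη.homogeneous p k (by omega)
  have h := hle hω'
  simp only [Submodule.mem_iInf, LinearMap.mem_ker] at h
  funext p k
  by_cases hp : p + 2 * k = n
  · exact h p k hp
  · exact hω.homogeneous p k hp

end Structure

section Lie

variable {R L : Type*} [CommRing R] [AddCommGroup L] [Module R L] [LeibnizAlgebra R L]

/-! ### The Lie derivative -/

theorem br_leibniz (x y z : L) : br R x (br R y z) = br R (br R x y) z + br R y (br R x z) :=
  left_leibniz x y z

theorem centerAction_coe (x : L) (z : leftCenter R L) :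
    (centerAction R x z : L) = br R x z := rfl

theorem br_coe_eq_zero (z : leftCenter R L) (x : L) : br R (z : L) x = 0 := z.2 x

theorem pairing_coe_right (x : L) (z : leftCenter R L) :
    pairing R x (z : L) = centerAction R x z := by
  ext
  simp [pairing, centerAction_coe, br_coe_eq_zero]

/-- Left multiplications are derivations of the symmetric product. -/
theorem centerAction_pairing (x y z : L) :
    centerAction R x (pairing R y z) = pairing R (br R x y) z + pairing R y (br R x z) := by
  ext
  have h : br R x (br R y z + br R z y) = br R x (br R y z) + br R x (br R z y) := map_add _ _ _
  simp only [centerAction_coe, pairing, Submodule.coe_add, h, br_leibniz x y z, br_leibniz x z y]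
  abel

theorem centerAction_br (x y : L) (z : leftCenter R L) :
    centerAction R x (centerAction R y z) =
      centerAction R (br R x y) z + centerAction R y (centerAction R x z) := by
  ext
  exact br_leibniz x y z

/-- Two derivations of a symmetric algebra which agree on the generators are equal. -/
theorem derivation_ext {M : Type*} [AddCommGroup M] [Module R M]
    {D₁ D₂ : Derivation R (SymmetricAlgebra R M) (SymmetricAlgebra R M)}
    (h : ∀ m, D₁ (SymmetricAlgebra.ι R M m) = D₂ (SymmetricAlgebra.ι R M m)) : D₁ = D₂ := by
  ext s
  induction s using SymmetricAlgebra.induction with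
  | algebraMap r => rw [Derivation.map_algebraMap, Derivation.map_algebraMap]
  | ι m => exact h m
  | mul a b ha hb => rw [Derivation.leibniz, Derivation.leibniz, ha, hb]
  | add a b ha hb => rw [map_add, map_add, ha, hb]

theorem rho_ι (x : L) (z : leftCenter R L) :
    rho R x (SymmetricAlgebra.ι R _ z) = SymmetricAlgebra.ι R _ (centerAction R x z) :=
  symDerivation_ι _ _

theorem rho_add (x y : L) : rho R (x + y) = rho R x + rho R y := derivation_ext fun m => by
  have h : centerAction R (x + y) m = centerAction R x m + centerAction R y m := by
    ext
    exact LinearMap.map_add₂ _ _ _ _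
  simp only [Derivation.add_apply, rho_ι, h, map_add]

theorem rho_smul (c : R) (x : L) : rho R (c • x) = c • rho R x := derivation_ext fun m => by
  have h : centerAction R (c • x) m = c • centerAction R x m := by
    ext
    exact LinearMap.map_smul₂ _ _ _ _
  simp only [Derivation.smul_apply, rho_ι, h, map_smul]

theorem rho_br (x y : L) (s : SZ R L) :
    rho R x (rho R y s) = rho R (br R x y) s + rho R y (rho R x s) := by
  have h : ⁅rho R x, rho R y⁆ = rho R (br R x y) := derivation_ext fun m => by
    simp only [Derivation.commutator_apply, rho_ι, centerAction_br x y m, map_add]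
    abel
  rw [← h, Derivation.commutator_apply]
  abel

theorem rho_coe (z : leftCenter R L) : rho R (z : L) = 0 := derivation_ext fun m => by
  have h : centerAction R (z : L) m = 0 := by
    ext
    exact br_coe_eq_zero z m
  simp [rho_ι, h]

/-- The Lie derivative along `x ∈ L`: the commutator of the action of `x` on the values with
its action `y ↦ x ∘ y` on each of the arguments. -/
def lieDeriv (x : L) : PreCochain R L →ₗ[R] PreCochain R L where
  toFun ω := fun p k e f => rho R x (ω p k e f)
    - ∑ b : Fin p, ω p k (Function.update e b (br R x (e b))) f
    - ∑ j : Fin k, ω p k e (Function.update f j (centerAction R x (f j)))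
  map_add' ω η := by
    funext p k e f
    simp only [Pi.add_apply, map_add, Finset.sum_add_distrib]
    abel
  map_smul' c ω := by
    funext p k e f
    simp only [Pi.smul_apply, Derivation.map_smul, ← Finset.smul_sum, ← smul_sub,
      RingHom.id_apply]

theorem lieDeriv_apply (x : L) (ω : PreCochain R L) (p k : ℕ) (e : Fin p → L)
    (f : Fin k → leftCenter R L) : lieDeriv x ω p k e f = rho R x (ω p k e f)
      - ∑ b : Fin p, ω p k (Function.update e b (br R x (e b))) f
      - ∑ j : Fin k, ω p k e (Function.update f j (centerAction R x (f j))) := rfl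

theorem lieDeriv_zero_zero (x : L) (ω : PreCochain R L) (e : Fin 0 → L)
    (f : Fin 0 → leftCenter R L) : lieDeriv x ω 0 0 e f = rho R x (ω 0 0 e f) := by
  simp [lieDeriv_apply]

theorem contractL_lieDeriv (y x : L) (ω : PreCochain R L) :
    contractL y (lieDeriv x ω) = lieDeriv x (contractL y ω) - contractL (br R x y) ω := by
  funext p k e f
  simp only [Pi.sub_apply, contractL_apply, lieDeriv_apply, Fin.sum_univ_succ, Fin.cons_zero,
    Fin.cons_succ, Fin.update_cons_zero, Fin.cons_update]
  abel

theorem contractZ_lieDeriv (z : leftCenter R L) (x : L) (ω : PreCochain R L) :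
    contractZ z (lieDeriv x ω) = lieDeriv x (contractZ z ω) - contractZ (centerAction R x z) ω := by
  funext p k e f
  simp only [Pi.sub_apply, contractZ_apply, lieDeriv_apply, Fin.sum_univ_succ, Fin.cons_zero,
    Fin.cons_succ, Fin.update_cons_zero, Fin.cons_update]
  abel

theorem parity_lieDeriv (x : L) (ω : PreCochain R L) :
    parity R L (lieDeriv x ω) = lieDeriv x (parity R L ω) := by
  funext p k e f
  simp only [parity_apply, lieDeriv_apply, map_zsmul, ← Finset.smul_sum, ← smul_sub]

/-- The Lie derivative is an even derivation of the shuffle product. -/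
theorem lieDeriv_mul (x : L) (ω η : PreCochain R L) :
    lieDeriv x (mul R L ω η) = mul R L (lieDeriv x ω) η + mul R L ω (lieDeriv x η) := by
  rw [← sub_eq_zero]
  set G : Set (PreCochain R L) := {ζ | ∃ x ω η, ζ = lieDeriv x (mul R L ω η) -
    (mul R L (lieDeriv x ω) η + mul R L ω (lieDeriv x η))} with hG
  have hmem : ∀ x ω η, lieDeriv x (mul R L ω η) -
      (mul R L (lieDeriv x ω) η + mul R L ω (lieDeriv x η)) ∈ Submodule.span R G :=
    fun x ω η => Submodule.subset_span ⟨x, ω, η, rfl⟩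
  refine eq_zero_of_contract_mem_span (G := G) ?_ ?_ ?_ ⟨x, ω, η, rfl⟩
  · rintro _ ⟨x, ω, η, rfl⟩
    funext e f
    simp only [Pi.sub_apply, Pi.add_apply, mul_zero_zero, lieDeriv_zero_zero, Derivation.leibniz,
      smul_eq_mul, Pi.zero_apply]
    ring
  · rintro _ ⟨x, ω, η, rfl⟩ y
    convert add_mem (hmem x (contractL y ω) η) (hmem x (parity R L ω) (contractL y η)) using 1
    simp only [map_sub, map_add, contractL_mul, contractL_lieDeriv, parity_lieDeriv,
      LinearMap.sub_apply]
    abel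
  · rintro _ ⟨x, ω, η, rfl⟩ z
    convert add_mem (hmem x (contractZ z ω) η) (hmem x ω (contractZ z η)) using 1
    simp only [map_sub, map_add, contractZ_mul, contractZ_lieDeriv, LinearMap.sub_apply]
    abel

/-- Lie derivatives of cochains and cochains together span a contraction stable submodule. The
Leibniz identity enters through `centerAction_pairing`. -/
theorem isContractionStable_sup_lieDeriv :
    IsContractionStable (Submodule.span R
      {ζ : PreCochain R L | ∃ x, ∃ ω ∈ ⨆ n, cochains R L n, ∃ η ∈ ⨆ n, cochains R L n,
        ζ = lieDeriv x ω + η}) := by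
  have hT := isContractionStable_iSup_cochains R L
  apply isContractionStable_span
  all_goals rintro _ ⟨u, ω, hω, η, hη, rfl⟩
  · exact fun x => Submodule.subset_span ⟨u, contractL x ω, hT.contractL_mem ω hω x,
      contractL x η - contractL (br R u x) ω,
      sub_mem (hT.contractL_mem η hη x) (hT.contractL_mem ω hω _), by
        rw [map_add, contractL_lieDeriv]
        abel⟩
  · exact fun z => Submodule.subset_span ⟨u, contractZ z ω, hT.contractZ_mem ω hω z,
      contractZ z η - contractZ (centerAction R u z) ω,
      sub_mem (hT.contractZ_mem η hη z) (hT.contractZ_mem ω hω _), by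
        rw [map_add, contractZ_lieDeriv]
        abel⟩
  · intro x y
    have h : br R u (x + y) = br R u x + br R u y := map_add _ _ _
    simp only [map_add, contractL_lieDeriv, hT.contractL_add η hη, hT.contractL_add ω hω, h]
    abel
  · intro c x
    have h : br R u (c • x) = c • br R u x := map_smul _ _ _
    simp only [map_add, map_smul, contractL_lieDeriv, hT.contractL_smul η hη,
      hT.contractL_smul ω hω, h, smul_add, smul_sub]
  · intro x y
    simp only [map_add, contractZ_lieDeriv, hT.contractZ_add η hη, hT.contractZ_add ω hω]
    abel
  · intro c x
    simp only [map_add, map_smul, contractZ_lieDeriv, hT.contractZ_smul η hη,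
      hT.contractZ_smul ω hω, smul_add, smul_sub]
  · intro x y
    simp only [map_add, map_sub, contractZ_lieDeriv, hT.contractZ_comm η hη x y,
      hT.contractZ_comm ω hω x y, hT.contractZ_comm ω hω x (centerAction R u y),
      hT.contractZ_comm ω hω y (centerAction R u x)]
    abel
  · intro x y
    have h₀ := congrArg (lieDeriv u) (hT.contractL_anticomm ω hω x y)
    have h₁ := hT.contractL_anticomm ω hω (br R u x) y
    have h₂ := hT.contractL_anticomm ω hω x (br R u y)
    have h₃ := hT.contractL_anticomm η hη x y
    simp only [map_add, map_sub, map_neg, contractL_lieDeriv, contractZ_lieDeriv,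
      centerAction_pairing, hT.contractZ_add ω hω] at h₀ ⊢
    rw [add_comm] at h₁
    linear_combination (exp := 1) h₀ - h₁ - h₂ + h₃

theorem lieDeriv_mem_cochains (x : L) {n : ℕ} {ω : PreCochain R L} (hω : ω ∈ cochains R L n) :
    lieDeriv x ω ∈ cochains R L n := by
  refine isContractionStable_sup_lieDeriv.mem_cochains (Submodule.subset_span
    ⟨x, ω, Submodule.mem_iSup_of_mem n hω, 0, zero_mem _, (add_zero _).symm⟩) fun p k h => ?_
  funext e f
  simp [lieDeriv_apply, hω.homogeneous p k h]

theorem lieDeriv_mem_iSup (x : L) {ω : PreCochain R L} (hω : ω ∈ ⨆ n, cochains R L n) :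
    lieDeriv x ω ∈ ⨆ n, cochains R L n := by
  have h : (⨆ n, cochains R L n) ≤ (⨆ n, cochains R L n).comap (lieDeriv x) :=
    iSup_le fun n ω hω => Submodule.mem_iSup_of_mem n (lieDeriv_mem_cochains x hω)
  exact h hω

theorem lieDeriv_add (x y : L) {ω : PreCochain R L} (hω : ω ∈ ⨆ n, cochains R L n) :
    lieDeriv (x + y) ω = lieDeriv x ω + lieDeriv y ω := by
  have hT := isContractionStable_iSup_cochains R L
  rw [← sub_eq_zero]
  refine eq_zero_of_contract_mem_span (G := {ζ | ∃ ω ∈ ⨆ n, cochains R L n,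
    ζ = lieDeriv (x + y) ω - (lieDeriv x ω + lieDeriv y ω)}) ?_ ?_ ?_ ⟨ω, hω, rfl⟩
  · rintro _ ⟨ω, hω, rfl⟩
    funext e f
    simp only [Pi.sub_apply, Pi.add_apply, lieDeriv_zero_zero, rho_add, Derivation.add_apply,
      sub_self, Pi.zero_apply]
  · rintro _ ⟨ω, hω, rfl⟩ u
    have h : br R (x + y) u = br R x u + br R y u := LinearMap.map_add₂ _ _ _ _
    refine Submodule.subset_span ⟨contractL u ω, hT.contractL_mem ω hω u, ?_⟩
    simp only [map_sub, map_add, contractL_lieDeriv, h, hT.contractL_add ω hω]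
    abel
  · rintro _ ⟨ω, hω, rfl⟩ z
    have h : centerAction R (x + y) z = centerAction R x z + centerAction R y z := by
      ext
      exact LinearMap.map_add₂ _ _ _ _
    refine Submodule.subset_span ⟨contractZ z ω, hT.contractZ_mem ω hω z, ?_⟩
    simp only [map_sub, map_add, contractZ_lieDeriv, h, hT.contractZ_add ω hω]
    abel

theorem lieDeriv_smul (c : R) (x : L) {ω : PreCochain R L} (hω : ω ∈ ⨆ n, cochains R L n) :
    lieDeriv (c • x) ω = c • lieDeriv x ω := by
  have hT := isContractionStable_iSup_cochains R L
  rw [← sub_eq_zero]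
  refine eq_zero_of_contract_mem_span (G := {ζ | ∃ ω ∈ ⨆ n, cochains R L n,
    ζ = lieDeriv (c • x) ω - c • lieDeriv x ω}) ?_ ?_ ?_ ⟨ω, hω, rfl⟩
  · rintro _ ⟨ω, hω, rfl⟩
    funext e f
    simp only [Pi.sub_apply, Pi.smul_apply, lieDeriv_zero_zero, rho_smul, Derivation.smul_apply,
      sub_self, Pi.zero_apply]
  · rintro _ ⟨ω, hω, rfl⟩ u
    have h : br R (c • x) u = c • br R x u := LinearMap.map_smul₂ _ _ _ _
    refine Submodule.subset_span ⟨contractL u ω, hT.contractL_mem ω hω u, ?_⟩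
    simp only [map_sub, map_smul, contractL_lieDeriv, h, hT.contractL_smul ω hω, smul_sub]
    abel
  · rintro _ ⟨ω, hω, rfl⟩ z
    have h : centerAction R (c • x) z = c • centerAction R x z := by
      ext
      exact LinearMap.map_smul₂ _ _ _ _
    refine Submodule.subset_span ⟨contractZ z ω, hT.contractZ_mem ω hω z, ?_⟩
    simp only [map_sub, map_smul, contractZ_lieDeriv, h, hT.contractZ_smul ω hω, smul_sub]
    abel

/-- The Lie derivatives form a representation of the Leibniz algebra on the cochains. -/
theorem lieDeriv_br (x y : L) {ω : PreCochain R L} (hω : ω ∈ ⨆ n, cochains R L n) :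
    lieDeriv x (lieDeriv y ω) = lieDeriv (br R x y) ω + lieDeriv y (lieDeriv x ω) := by
  have hT := isContractionStable_iSup_cochains R L
  rw [← sub_eq_zero]
  refine eq_zero_of_contract_mem_span (G := {ζ | ∃ ω ∈ ⨆ n, cochains R L n,
    ζ = lieDeriv x (lieDeriv y ω) - (lieDeriv (br R x y) ω + lieDeriv y (lieDeriv x ω))})
    ?_ ?_ ?_ ⟨ω, hω, rfl⟩
  · rintro _ ⟨ω, hω, rfl⟩
    funext e f
    simp only [Pi.sub_apply, Pi.add_apply, lieDeriv_zero_zero, rho_br x y, sub_self, Pi.zero_apply]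
  · rintro _ ⟨ω, hω, rfl⟩ u
    refine Submodule.subset_span ⟨contractL u ω, hT.contractL_mem ω hω u, ?_⟩
    simp only [map_sub, map_add, contractL_lieDeriv, br_leibniz x y u, hT.contractL_add ω hω]
    abel
  · rintro _ ⟨ω, hω, rfl⟩ z
    refine Submodule.subset_span ⟨contractZ z ω, hT.contractZ_mem ω hω z, ?_⟩
    simp only [map_sub, map_add, contractZ_lieDeriv, centerAction_br x y z,
      hT.contractZ_add ω hω]
    abel

/-- The left center acts trivially. -/
theorem lieDeriv_coe (z : leftCenter R L) {ω : PreCochain R L} (hω : ω ∈ ⨆ n, cochains R L n) :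
    lieDeriv (z : L) ω = 0 := by
  have hT := isContractionStable_iSup_cochains R L
  refine eq_zero_of_contract_mem_span (G := {ζ | ∃ ω ∈ ⨆ n, cochains R L n,
    ζ = lieDeriv (z : L) ω}) ?_ ?_ ?_ ⟨ω, hω, rfl⟩
  · rintro _ ⟨ω, hω, rfl⟩
    funext e f
    rw [lieDeriv_zero_zero, rho_coe]
    rfl
  · rintro _ ⟨ω, hω, rfl⟩ u
    refine Submodule.subset_span ⟨contractL u ω, hT.contractL_mem ω hω u, ?_⟩
    have h : contractL (0 : L) ω = 0 := by
      have h := hT.contractL_smul ω hω 0 0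
      rwa [zero_smul, zero_smul] at h
    rw [contractL_lieDeriv, br_coe_eq_zero, h, sub_zero]
  · rintro _ ⟨ω, hω, rfl⟩ u
    refine Submodule.subset_span ⟨contractZ u ω, hT.contractZ_mem ω hω u, ?_⟩
    have h : contractZ (0 : leftCenter R L) ω = 0 := by
      have h := hT.contractZ_smul ω hω 0 0
      rwa [zero_smul, zero_smul] at h
    have h' : centerAction R (z : L) u = 0 := by
      ext
      exact br_coe_eq_zero z u
    rw [contractZ_lieDeriv, h', h, sub_zero]

end Lie

section Differential

variable {R L : Type*} [CommRing R] [AddCommGroup L] [Module R L] [LeibnizAlgebra R L]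

/-! ### The differential -/

theorem d₀_zero (ω : PreCochain R L) (k : ℕ) (e : Fin 0 → L) (f : Fin k → leftCenter R L) :
    d₀ R L ω 0 k e f = 0 := rfl

theorem d₀_succ (ω : PreCochain R L) (p k : ℕ) (e : Fin (p + 1) → L)
    (f : Fin k → leftCenter R L) : d₀ R L ω (p + 1) k e f =
      (∑ a : Fin (p + 1), (-1 : ℤ) ^ (a : ℕ) • rho R (e a) (ω p k (Fin.removeNth a e) f))
      + ∑ a : Fin (p + 1), ∑ b ∈ Finset.univ.filter (fun b : Fin (p + 1) => a < b),
          (-1 : ℤ) ^ ((a : ℕ) + 1) •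
            ω p k (Fin.removeNth a (Function.update e b (br R (e a) (e b)))) f := rfl

theorem δ_zero (ω : PreCochain R L) (p : ℕ) (e : Fin p → L) (f : Fin 0 → leftCenter R L) :
    δ R L ω p 0 e f = 0 := by
  cases p <;> rfl

theorem δ_succ (ω : PreCochain R L) (p k : ℕ) (e : Fin p → L)
    (f : Fin (k + 1) → leftCenter R L) : δ R L ω p (k + 1) e f =
      ∑ j : Fin (k + 1), ω (p + 1) k (Fin.cons (f j : L) e) (Fin.removeNth j f) := by
  cases p <;> rfl

theorem d_apply (ω : PreCochain R L) (p k : ℕ) (e : Fin p → L) (f : Fin k → leftCenter R L) :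
    d R L ω p k e f = d₀ R L ω p k e f + δ R L ω p k e f := rfl

theorem d_zero_zero (ω : PreCochain R L) : d R L ω 0 0 = 0 := by
  funext e f
  rw [d_apply, d₀_zero, δ_zero, add_zero]
  rfl

theorem contractL_d₀ (x : L) (ω : PreCochain R L) (p k : ℕ) (e : Fin p → L)
    (f : Fin k → leftCenter R L) : contractL x (d₀ R L ω) p k e f =
      - d₀ R L (contractL x ω) p k e f + (rho R x (ω p k e f)
        - ∑ b : Fin p, ω p k (Function.update e b (br R x (e b))) f) := by
  have hlt : ∀ {n : ℕ} (a : Fin n) (F : Fin n → SZ R L),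
      ∑ b ∈ Finset.univ.filter (fun b => a < b), F b = ∑ b, if a < b then F b else 0 :=
    fun a F => Finset.sum_filter _ _
  cases p with
  | zero =>
    rw [contractL_apply, d₀_succ, d₀_zero]
    have h : Fin.tail (Fin.cons x e : Fin 1 → L) = e := Fin.tail_cons _ _
    simp only [hlt]
    simp [h]
  | succ p =>
    rw [contractL_apply, d₀_succ, d₀_succ]
    simp only [hlt, contractL_apply]
    -- The terms in which the first argument is the one that acts are split off; the others form
    -- the differential of the contraction, with the opposite sign.
    rw [Fin.sum_univ_succ (n := p + 1)]
    rw [Fin.sum_univ_succ (n := p + 1) (f := fun a => ∑ b, _)]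
    simp only [Fin.sum_univ_succ (n := p + 1) (f := fun b => ite _ _ _), Fin.cons_zero,
      Fin.cons_succ, lt_irrefl, if_false, zero_add, Fin.succ_pos, if_true, Fin.not_lt_zero,
      Fin.succ_lt_succ_iff, Fin.val_zero, pow_zero, one_smul, neg_smul,
      ← Fin.cons_update, removeNth_succ_cons, Fin.removeNth_zero, Fin.tail_cons, Fin.val_succ,
      pow_succ, mul_neg, mul_one, neg_neg]
    have hneg : ∀ (c : Prop) [Decidable c] (s : SZ R L),
        (if c then -s else 0) = -(if c then s else 0) := fun c _ s => by split_ifs <;> simp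
    simp only [hneg, Finset.sum_neg_distrib]
    abel

/-- For symmetric, weakly skew-symmetric families, moving `x` past the argument inserted by `δ`
produces the action of `x` on the arguments from the left center. -/
theorem contractL_δ (x : L) {ω : PreCochain R L} (hω : ω ∈ ⨆ n, cochains R L n) (p k : ℕ)
    (e : Fin p → L) (f : Fin k → leftCenter R L) : contractL x (δ R L ω) p k e f =
      - δ R L (contractL x ω) p k e f
        - ∑ j : Fin k, ω p k e (Function.update f j (centerAction R x (f j))) := by
  have hT := isContractionStable_iSup_cochains R L
  cases k with
  | zero => simp [contractL_apply, δ_zero]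
  | succ k =>
    rw [contractL_apply, δ_succ, δ_succ, ← Finset.sum_neg_distrib, ← Finset.sum_sub_distrib]
    refine Finset.sum_congr rfl fun j _ => ?_
    have h := congrFun (congrFun (congrFun (congrFun
      (hT.contractL_anticomm ω hω x (f j)) p) k) e) (Fin.removeNth j f)
    have hs := hT.symmetric p (k + 1) e (Function.update f j (centerAction R x (f j)))
      j.cycleRange.symm ω hω
    -- By symmetry the new argument `x ∘ f j` may be moved back from the front to position `j`.
    rw [← Fin.cons_removeNth_eq_comp_cycleRange_symm, Function.update_self,
      Fin.removeNth_update] at hs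
    rw [← hs]
    rw [pairing_coe_right] at h
    exact (eq_neg_add_of_add_eq ((add_comm _ _).trans h)).trans (by
      simp only [Pi.neg_apply, contractL_apply, contractZ_apply]
      abel)

/-- Cartan's formula for contractions with elements of `L`. -/
theorem contractL_d (x : L) {ω : PreCochain R L} (hω : ω ∈ ⨆ n, cochains R L n) :
    contractL x (d R L ω) = - d R L (contractL x ω) + lieDeriv x ω := by
  funext p k e f
  have h₀ := contractL_d₀ x ω p k e f
  have h₁ := contractL_δ x hω p k e f
  simp only [contractL_apply] at h₀ h₁
  simp only [contractL_apply, Pi.add_apply, Pi.neg_apply, d_apply, lieDeriv_apply, h₀, h₁]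
  abel

/-- Cartan's formula for contractions with elements of the left center. -/
theorem contractZ_d (z : leftCenter R L) (ω : PreCochain R L) :
    contractZ z (d R L ω) = d R L (contractZ z ω) + contractL (z : L) ω := by
  funext p k e f
  have h₀ : d₀ R L ω p (k + 1) e (Fin.cons z f) = d₀ R L (contractZ z ω) p k e f := by
    cases p <;> rfl
  have h₁ : δ R L ω p (k + 1) e (Fin.cons z f) =
      δ R L (contractZ z ω) p k e f + contractL (z : L) ω p k e f := by
    rw [δ_succ, Fin.sum_univ_succ, add_comm]
    congr 1
    cases k with
    | zero => rw [δ_zero]; rfl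
    | succ k =>
      rw [δ_succ]
      simp only [Fin.cons_succ, removeNth_succ_cons]
      rfl
  simp only [contractZ_apply, Pi.add_apply, d_apply, h₀, h₁]
  abel

theorem d_homogeneous {n : ℕ} {ω : PreCochain R L} (hω : ω ∈ cochains R L n) (p k : ℕ)
    (h : p + 2 * k ≠ n + 1) : d R L ω p k = 0 := by
  funext e f
  have h₀ : d₀ R L ω p k e f = 0 := by
    cases p with
    | zero => rfl
    | succ p =>
      rw [d₀_succ, hω.homogeneous p k (by omega)]
      simp
  have h₁ : δ R L ω p k e f = 0 := by
    cases k with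
    | zero => exact δ_zero _ _ _ _
    | succ k =>
      rw [δ_succ, hω.homogeneous (p + 1) k (by omega)]
      simp
  rw [d_apply, h₀, h₁, add_zero]
  rfl

/-- Differentials of cochains and cochains together span a contraction stable submodule, by Cartan's
formulas. -/
theorem isContractionStable_sup_d :
    IsContractionStable (Submodule.span R
      {ζ : PreCochain R L | ∃ ω ∈ ⨆ n, cochains R L n, ∃ η ∈ ⨆ n, cochains R L n,
        ζ = d R L ω + η}) := by
  have hT := isContractionStable_iSup_cochains R L
  apply isContractionStable_span
  all_goals rintro _ ⟨ω, hω, η, hη, rfl⟩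
  · exact fun x => Submodule.subset_span ⟨- contractL x ω, neg_mem (hT.contractL_mem ω hω x),
      lieDeriv x ω + contractL x η,
      add_mem (lieDeriv_mem_iSup x hω) (hT.contractL_mem η hη x), by
        rw [map_add, contractL_d x hω, map_neg, add_assoc]⟩
  · exact fun z => Submodule.subset_span ⟨contractZ z ω, hT.contractZ_mem ω hω z,
      contractL (z : L) ω + contractZ z η,
      add_mem (hT.contractL_mem ω hω _) (hT.contractZ_mem η hη z), by
        rw [map_add, contractZ_d, add_assoc]⟩
  · intro x y
    have h : lieDeriv (x + y) ω = lieDeriv x ω + lieDeriv y ω := lieDeriv_add x y hω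
    simp only [map_add, contractL_d _ hω, hT.contractL_add η hη, hT.contractL_add ω hω, h]
    abel
  · intro c x
    have h : lieDeriv (c • x) ω = c • lieDeriv x ω := lieDeriv_smul c x hω
    simp only [map_add, map_smul, contractL_d _ hω, hT.contractL_smul η hη,
      hT.contractL_smul ω hω, h, smul_add, smul_neg]
  · intro x y
    simp only [map_add, contractZ_d, hT.contractZ_add η hη, hT.contractZ_add ω hω,
      Submodule.coe_add, hT.contractL_add ω hω]
    abel
  · intro c x
    simp only [map_add, map_smul, contractZ_d, hT.contractZ_smul η hη,
      hT.contractZ_smul ω hω, smul_add, Submodule.coe_smul, hT.contractL_smul ω hω]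
  · intro x y
    simp only [map_add, contractZ_d, hT.contractZ_comm η hη x y, hT.contractZ_comm ω hω x y,
      contractL_contractZ]
    abel
  · intro x y
    have h₀ := congrArg (d R L) (hT.contractL_anticomm ω hω x y)
    have h₁ : contractL (br R x y) ω + contractL (br R y x) ω =
        contractL (pairing R x y : L) ω := (hT.contractL_add ω hω _ _).symm
    have h₂ := hT.contractL_anticomm η hη x y
    simp only [map_add, map_neg, contractL_d _ hω, contractL_d _ (hT.contractL_mem ω hω _),
      contractL_lieDeriv, contractZ_d] at h₀ ⊢
    linear_combination (exp := 1) h₀ - h₁ + h₂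

theorem d_mem_cochains {n : ℕ} {ω : PreCochain R L} (hω : ω ∈ cochains R L n) :
    d R L ω ∈ cochains R L (n + 1) :=
  isContractionStable_sup_d.mem_cochains (Submodule.subset_span
    ⟨ω, Submodule.mem_iSup_of_mem n hω, 0, zero_mem _, (add_zero _).symm⟩) (d_homogeneous hω)

theorem d_mem_iSup {ω : PreCochain R L} (hω : ω ∈ ⨆ n, cochains R L n) :
    d R L ω ∈ ⨆ n, cochains R L n := by
  have h : (⨆ n, cochains R L n) ≤ (⨆ n, cochains R L n).comap (d R L) :=
    iSup_le fun n ω hω => Submodule.mem_iSup_of_mem (n + 1) (d_mem_cochains hω)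
  exact h hω

theorem parity_d {ω : PreCochain R L} (hω : ω ∈ ⨆ n, cochains R L n) :
    parity R L (d R L ω) = - d R L (parity R L ω) := by
  induction hω using Submodule.iSup_induction' with
  | zero => simp
  | add ω₁ ω₂ _ _ h₁ h₂ => rw [map_add, map_add, map_add, map_add, h₁, h₂, neg_add]
  | mem n ω hω =>
    rw [parity_eq_of_mem (d_mem_cochains hω), parity_eq_of_mem hω, map_zsmul, pow_succ,
      mul_neg_one, neg_smul]

/-- The Lie derivatives commute with the differential. -/
theorem lieDeriv_d (x : L) {ω : PreCochain R L} (hω : ω ∈ ⨆ n, cochains R L n) :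
    lieDeriv x (d R L ω) = d R L (lieDeriv x ω) := by
  have hT := isContractionStable_iSup_cochains R L
  rw [← sub_eq_zero]
  refine eq_zero_of_contract_mem_span (G := {ζ | ∃ ω ∈ ⨆ n, cochains R L n,
    ζ = lieDeriv x (d R L ω) - d R L (lieDeriv x ω)}) ?_ ?_ ?_ ⟨ω, hω, rfl⟩
  · rintro _ ⟨ω, hω, rfl⟩
    funext e f
    simp only [Pi.sub_apply, lieDeriv_zero_zero, d_zero_zero, Pi.zero_apply, map_zero, sub_self]
  · rintro _ ⟨ω, hω, rfl⟩ y
    refine Submodule.subset_span ⟨- contractL y ω, neg_mem (hT.contractL_mem ω hω y), ?_⟩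
    simp only [map_sub, map_add, map_neg, contractL_lieDeriv, contractL_d _ hω,
      contractL_d _ (lieDeriv_mem_iSup x hω), lieDeriv_br x y hω]
    abel
  · rintro _ ⟨ω, hω, rfl⟩ z
    refine Submodule.subset_span ⟨contractZ z ω, hT.contractZ_mem ω hω z, ?_⟩
    simp only [map_sub, map_add, contractZ_lieDeriv, contractZ_d, contractL_lieDeriv,
      centerAction_coe]
    abel

theorem d_d_eq_zero {ω : PreCochain R L} (hω : ω ∈ ⨆ n, cochains R L n) :
    d R L (d R L ω) = 0 := by
  have hT := isContractionStable_iSup_cochains R L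
  refine eq_zero_of_contract_mem_span (G := {ζ | ∃ ω ∈ ⨆ n, cochains R L n,
    ζ = d R L (d R L ω)}) ?_ ?_ ?_ ⟨ω, hω, rfl⟩
  · rintro _ ⟨ω, hω, rfl⟩
    exact d_zero_zero _
  · rintro _ ⟨ω, hω, rfl⟩ x
    refine Submodule.subset_span ⟨contractL x ω, hT.contractL_mem ω hω x, ?_⟩
    rw [contractL_d x (d_mem_iSup hω), contractL_d x hω, lieDeriv_d x hω, map_add, map_neg]
    abel
  · rintro _ ⟨ω, hω, rfl⟩ z
    refine Submodule.subset_span ⟨contractZ z ω, hT.contractZ_mem ω hω z, ?_⟩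
    rw [contractZ_d, contractZ_d, contractL_d _ hω, lieDeriv_coe z hω, map_add]
    abel

/-- The graded Leibniz rule, with the sign expressed by `parity`. -/
theorem d_mul {ω η : PreCochain R L} (hω : ω ∈ ⨆ n, cochains R L n)
    (hη : η ∈ ⨆ n, cochains R L n) : d R L (mul R L ω η) =
      mul R L (d R L ω) η + mul R L (parity R L ω) (d R L η) := by
  have hT := isContractionStable_iSup_cochains R L
  rw [← sub_eq_zero]
  set G : Set (PreCochain R L) := {ζ | ∃ ω ∈ ⨆ n, cochains R L n, ∃ η ∈ ⨆ n, cochains R L n,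
    ζ = d R L (mul R L ω η) - (mul R L (d R L ω) η + mul R L (parity R L ω) (d R L η))} with hG
  have hmem : ∀ ω η, ω ∈ ⨆ n, cochains R L n → η ∈ ⨆ n, cochains R L n →
      d R L (mul R L ω η) - (mul R L (d R L ω) η + mul R L (parity R L ω) (d R L η)) ∈
        Submodule.span R G :=
    fun ω η h₁ h₂ => Submodule.subset_span ⟨ω, h₁, η, h₂, rfl⟩
  refine eq_zero_of_contract_mem_span (G := G) ?_ ?_ ?_ ⟨ω, hω, η, hη, rfl⟩
  · rintro _ ⟨ω, hω, η, hη, rfl⟩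
    funext e f
    simp only [Pi.sub_apply, Pi.add_apply, mul_zero_zero, d_zero_zero, Pi.zero_apply, mul_zero,
      zero_mul, add_zero, sub_self]
  · rintro _ ⟨ω, hω, η, hη, rfl⟩ x
    convert neg_mem (add_mem (hmem _ _ (hT.contractL_mem ω hω x) hη)
      (hmem _ _ (parity_mem_iSup hω) (hT.contractL_mem η hη x))) using 1
    have h : d R L (parity R L ω) = - parity R L (d R L ω) := by rw [parity_d hω, neg_neg]
    simp only [map_sub, map_add, map_neg, contractL_d x (mul_mem_iSup hω hη), contractL_mul,
      contractL_d x hω, contractL_d x hη, contractL_parity, parity_parity, lieDeriv_mul, h,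
      LinearMap.add_apply, LinearMap.neg_apply]
    abel
  · rintro _ ⟨ω, hω, η, hη, rfl⟩ z
    convert add_mem (hmem _ _ (hT.contractZ_mem ω hω z) hη)
      (hmem _ _ hω (hT.contractZ_mem η hη z)) using 1
    simp only [map_sub, map_add, contractZ_d, contractZ_mul, contractL_mul, contractZ_parity,
      LinearMap.add_apply]
    abel

end Differential

end LeibnizAlgebra

theorem proposition2p2 (R : Type*) (L : Type*) [CommRing R] [AddCommGroup L] [Module R L]
    [LeibnizAlgebra R L] :
    IsDGCA (LeibnizAlgebra.cochains R L) (LeibnizAlgebra.mul R L) (LeibnizAlgebra.one R L)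
      (LeibnizAlgebra.d R L) where
  independent := LeibnizAlgebra.iSupIndep_cochains R L
  mul_mem := LeibnizAlgebra.mul_mem_cochains
  one_mem := LeibnizAlgebra.one_mem_cochains R L
  d_mem := LeibnizAlgebra.d_mem_cochains
  one_mul _ := LeibnizAlgebra.one_mul_eq _
  mul_one _ := LeibnizAlgebra.mul_one_eq _
  mul_assoc _ _ _ := LeibnizAlgebra.mul_assoc_eq _ _ _
  mul_comm hx hy := LeibnizAlgebra.mul_comm_of_parity (LeibnizAlgebra.parity_eq_of_mem hx)
    (LeibnizAlgebra.parity_eq_of_mem hy)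
  d_d hx := LeibnizAlgebra.d_d_eq_zero hx
  leibniz {n m x y} hx hy := by
    rw [LeibnizAlgebra.d_mul (Submodule.mem_iSup_of_mem n hx) (Submodule.mem_iSup_of_mem m hy),
      LeibnizAlgebra.parity_eq_of_mem hx, map_zsmul, LinearMap.smul_apply]
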